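/- Let $X$ be a nonempty standard Borel space and $\mathcal R$ a Borel equivalence relation with countable classes on $X$. All graphs are graphs in the sense of Serre: vertices, oriented edges, origin $o$, terminus $t$, and a fixed-point free involution $a\mapsto\bar a$ with $o(\bar a)=t(a)$. **Arboretums.** An *$\mathcal R$-space* is a standard Borel space $F$ with a Borel map $\pi:F\to X$ with countable fibres and a Borel action $((x,y),f)\mapsto (x,y)\cdot f\in\pi^{-1}(x)$, for $x\,\mathcal R\,y$ and $f\in\pi^{-1}(y)$, such that $(z,z)\cdot f=f$ and $(x,y)\cdot((y,z)\cdot f)=(x,z)\cdot f$; $\mathcal R_F$ denotes the orbit equivalence relation on $F$. An *$\mathcal R$-arboretum* $\mathcal A$ on $X$ is a graph whose sets of vertices $\mathcal A^0$ and of edges $\mathcal A^1$ are $\mathcal R$-spaces, for which $o,t,\bar{\ }$ are Borel, fibre-preserving and $\mathcal R$-equivariant, and whose fibre $\mathcal A_x$ is a tree for every $x\in X$ (edge fibres may be empty). **Graphs of relations.** A *graph of relations* $G^r$ is a countable graph $G$ with, for each vertex $P$ and each edge $a$, a standard Borel space $Y_P$, resp. $Y_a$, with a countable Borel equivalence relation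 $\mathcal R_P$, resp. $\mathcal R_a$, such that $(Y_{\bar a},\mathcal R_{\bar a})=(Y_a,\mathcal R_a)$, and for each edge $a$ an injective Borel map $i_a:Y_a\to Y_{t(a)}$ sending $\mathcal R_a$-equivalent points to $\mathcal R_{t(a)}$-equivalent points. A *rooted maximal subtree* of $G^r$ is a subtree $T$ of $G$ containing all vertices, with a vertex (root) $P_0$ such that $Y_{P_0}$ meets exactly once each class of the equivalence relation on $\bigsqcup_P Y_P$ generated by $i_{\bar a}(e)\sim i_a(e)$ ($a$ an edge of $T$, $e\in Y_a$). The points of $\bigsqcup_P Y_P$ and of $\bigsqcup_{a\in T}Y_a$ are then the vertices and the edges of an arboretum over $Y_{P_0}$, the edge $e\in Y_a$ going from $i_{\bar a}(e)$ to $i_a(e)$. A *representation* $\chi$ of the tree in $\mathcal A$ is an isomorphism of $Y_{P_0}$ with a Borel subset of $X$ and a compatible injective Borel graph morphism from this arboretum into $\mathcal A$, which identifies $\mathcal R_P$ and $\mathcal R_a$ ($a\in T$) with the restrictions of $\mathcal R_{\mathcal A^0}$ and $\mathcal R_{\mathcal A^1}$ to $\chi(Y_P)$ and $\chi(Y_a)$.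 Through $\pi\circ\chi$, each $Y_P$ is identified with a subset of $X$. **Theorem.** For every $\mathcal R$-arboretum $\mathcal A$ on $X$ there exists a desingularization of the action of $\mathcal R$ on $\mathcal A$, that is: a graph of relations $G^r$ with an orientation of $G$ (one edge chosen in each pair $\{a,\bar a\}$), a rooted maximal subtree $T$, a representation $\chi$ of it in $\mathcal A$, and, for each edge $a\notin T$ of the orientation, a Borel isomorphism $\phi_a\in[[\mathcal R]]$ between Borel subsets of $X$, with graph in $\mathcal R$, such that 1. the base isomorphism of $\chi$ identifies $Y_{P_0}$ with all of $X$, and the $\mathcal R_{\mathcal A^0}$-saturations of the sets $\chi(Y_P)$, $P$ a vertex of $G$, form a partition of $\mathcal A^0$; 2. for each edge $a\notin T$ of the orientation there is a Borel section $s_a:\mathrm{dom}(\phi_a)\to\mathcal A^1$ of the projection such that, for all $x\in\mathrm{dom}(\phi_a)$, $o(s_a(x))\in\chi(Y_{o(a)})$ and $(\phi_a(x),x)\cdot t(s_a(x))\in\chi(Y_{t(a)})$; 3. for each such $a$, let $\mathrm{Stab}_{\mathcal R}(s_a)$ be the relation "$s_a(x)\,\mathcal R_{\mathcal A^1}\,s_a(y)$"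 on $\mathrm{dom}(\phi_a)$. Then $\pi\circ\chi$ induces an isomorphism of the image of $\mathcal R_a$ under $i_{\bar a}$ with $\mathrm{Stab}_{\mathcal R}(s_a)$, and of the image of $\mathcal R_a$ under $i_a$ with $\phi_a\mathrm{Stab}_{\mathcal R}(s_a)\phi_a^{-1}$ on $\phi_a(\mathrm{dom}(\phi_a))$, and these are compatible: $\phi_a(\pi\chi(i_{\bar a}(e)))=\pi\chi(i_a(e))$ for $e\in Y_a$; 4. the $\mathcal R_{\mathcal A^1}$-saturations of the sets $\chi(Y_a)$ ($a$ an edge of $T$, in both directions) and $s_a(\mathrm{dom}(\phi_a))$ ($a\notin T$ an edge of the orientation) form a partition of $\mathcal A^1$. Partitions are countable families of nonempty pairwise disjoint sets. -/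

import Mathlib

universe u v w

/-- A Borel equivalence relation with countable classes on a Borel space. -/
structure BorelEqRel (X : Type u) [MeasurableSpace X] extends Setoid X where
  measurableSet_graph : MeasurableSet {p : X × X | toSetoid p.1 p.2}
  countable_class : ∀ x, {y | toSetoid x y}.Countable

/-- A standard Borel space carrying a Borel equivalence relation with countable classes. -/
structure BorelRelSpace where
  carrier : Type u
  [meas : MeasurableSpace carrier]
  [std : StandardBorelSpace carrier]
  rel : BorelEqRel carrier

attribute [instance] BorelRelSpace.meas BorelRelSpace.std

/-- A family of sets is a partition of the ambient type: nonempty, pairwise disjoint members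
which cover everything. -/
def IsPartitionFamily {ι : Type u} {α : Type v} (s : ι → Set α) : Prop :=
  (∀ i, (s i).Nonempty) ∧ (∀ i j, i ≠ j → Disjoint (s i) (s j)) ∧ (⋃ i, s i) = Set.univ

/-! ### Graphs in the sense of Serre -/

/-- A graph with vertex set `V` and set of (oriented) edges `E`: origin, terminus, and a
fixed-point free involution `e ↦ inv e` (the opposite edge) exchanging origin and terminus. -/
structure SerreGraph (V : Type v) (E : Type w) where
  org : E → V
  ter : E → V
  inv : E → E
  inv_inv : ∀ e, inv (inv e) = e
  inv_ne : ∀ e, inv e ≠ e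
  org_inv : ∀ e, org (inv e) = ter e

namespace SerreGraph

variable {V : Type v} {E : Type w} (G : SerreGraph V E)

theorem ter_inv (e : E) : G.ter (G.inv e) = G.org e := by
  rw [← G.org_inv, G.inv_inv]

/-- The adjacency relation between distinct vertices. -/
def adjGraph : SimpleGraph V where
  Adj P Q := P ≠ Q ∧ ∃ e, G.org e = P ∧ G.ter e = Q
  symm := ⟨by
    rintro P Q ⟨hne, e, ho, ht⟩
    exact ⟨hne.symm, G.inv e, by rw [G.org_inv, ht], by rw [G.ter_inv, ho]⟩⟩
  loopless := ⟨fun _ h => h.1 rfl⟩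

/-- A tree: a nonempty connected graph without circuits, that is, without circuits of length `1`
(loops), of length `2` (multiple edges), or of length at least `3`. -/
def IsTree : Prop :=
  (∀ e, G.org e ≠ G.ter e) ∧
  (∀ e e', G.org e = G.org e' → G.ter e = G.ter e' → e = e') ∧
  G.adjGraph.IsTree

/-- The subgraph with the same vertices and with a set of edges stable under `inv`. -/
def restrictEdges (T : Set E) (hT : ∀ e ∈ T, G.inv e ∈ T) : SerreGraph V T where
  org e := G.org e
  ter e := G.ter e
  inv e := ⟨G.inv e, hT e e.2⟩
  inv_inv e := Subtype.ext (G.inv_inv e)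
  inv_ne e h := G.inv_ne e (congrArg Subtype.val h)
  org_inv e := G.org_inv e

end SerreGraph

/-! ### Actions of an equivalence relation on fibred spaces and fields of graphs -/

section Actions

variable {X : Type u} [MeasurableSpace X]

/-- A Borel projection `F → X` with countable fibres, together with a left action of `R`:
`act x t _` is `(x, y) · t`, where `y = proj t` is `R`-equivalent to `x`. -/
structure FiberedAction (R : BorelEqRel X) (F : Type v) [MeasurableSpace F] where
  proj : F → X
  measurable_proj : Measurable proj
  countable_fiber : ∀ x, (proj ⁻¹' {x}).Countable
  act : (x : X) → (t : F) → R.toSetoid x (proj t) → F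
  measurable_act :
    Measurable fun q : {q : X × F // R.toSetoid q.1 (proj q.2)} => act q.1.1 q.1.2 q.2
  proj_act : ∀ x t h, proj (act x t h) = x
  act_self : ∀ t, act (proj t) t (R.toSetoid.refl (proj t)) = t
  act_act : ∀ (x y : X) (t : F) (hxy : R.toSetoid x y) (hy : R.toSetoid y (proj t)),
    act x (act y t hy) ((proj_act y t hy).symm ▸ hxy) = act x t (R.toSetoid.trans hxy hy)

namespace FiberedAction

variable {R : BorelEqRel X} {F : Type v} [MeasurableSpace F] {F' : Type w} [MeasurableSpace F']

/-- The equivalence relation `R_F` on `F`: being in the same orbit. -/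
def OrbitRel (Φ : FiberedAction R F) (f f' : F) : Prop :=
  ∃ h : R.toSetoid (Φ.proj f) (Φ.proj f'), Φ.act (Φ.proj f) f' h = f

/-- The `R_F`-saturation of a subset of `F`. -/
def saturation (Φ : FiberedAction R F) (S : Set F) : Set F :=
  {f | ∃ f' ∈ S, Φ.OrbitRel f f'}

/-- Morphisms of fibred spaces with `R`-action: Borel, fibre preserving, equivariant. -/
structure IsMorphism (Φ : FiberedAction R F) (Φ' : FiberedAction R F') (f : F → F') : Prop where
  measurable : Measurable f
  proj_map : ∀ t, Φ'.proj (f t) = Φ.proj t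
  map_act : ∀ x t (h : R.toSetoid x (Φ.proj t)),
    f (Φ.act x t h) = Φ'.act x (f t) ((proj_map t).symm ▸ h)

end FiberedAction

/-- A Borel field of graphs on `X` with an action of `R`. The fibres of the vertex space are
nonempty; fibres of the edge space may be empty (a tree may consist of a single vertex). -/
structure BorelGraphField (R : BorelEqRel X) (V : Type v) (E : Type w)
    [MeasurableSpace V] [MeasurableSpace E] where
  vert : FiberedAction R V
  edge : FiberedAction R E
  vert_surjective : Function.Surjective vert.proj
  graph : SerreGraph V E
  org_morphism : edge.IsMorphism vert graph.org
  ter_morphism : edge.IsMorphism vert graph.ter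
  inv_morphism : edge.IsMorphism edge graph.inv

namespace BorelGraphField

variable {R : BorelEqRel X} {V : Type v} {E : Type w} [MeasurableSpace V] [MeasurableSpace E]

/-- The fibre over `x`. -/
def fiber (A : BorelGraphField R V E) (x : X) :
    SerreGraph {p : V // A.vert.proj p = x} {e : E // A.edge.proj e = x} where
  org e := ⟨A.graph.org e, (A.org_morphism.proj_map e).trans e.2⟩
  ter e := ⟨A.graph.ter e, (A.ter_morphism.proj_map e).trans e.2⟩
  inv e := ⟨A.graph.inv e, (A.inv_morphism.proj_map e).trans e.2⟩
  inv_inv e := Subtype.ext (A.graph.inv_inv e)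
  inv_ne e h := A.graph.inv_ne e (congrArg Subtype.val h)
  org_inv e := Subtype.ext (A.graph.org_inv e)

/-- An `R`-arboretum: every fibre is a tree. -/
def IsArboretum (A : BorelGraphField R V E) : Prop :=
  ∀ x, (A.fiber x).IsTree

end BorelGraphField

/-- An element of the full pseudogroup `[[R]]`: a Borel isomorphism between Borel subsets
`source` and `target` of `X` whose graph is contained in `R`. -/
structure FullPseudogroup (R : BorelEqRel X) where
  toPartialEquiv : PartialEquiv X X
  measurableSet_source : MeasurableSet toPartialEquiv.source
  measurableSet_target : MeasurableSet toPartialEquiv.target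
  measurable_toFun : Measurable fun x : toPartialEquiv.source => toPartialEquiv x
  measurable_invFun : Measurable fun y : toPartialEquiv.target => toPartialEquiv.symm y
  rel : ∀ x ∈ toPartialEquiv.source, R.toSetoid (toPartialEquiv x) x

namespace FullPseudogroup

variable {R : BorelEqRel X} (φ : FullPseudogroup R)

/-- The domain of `φ`. -/
abbrev source : Set X := φ.toPartialEquiv.source

/-- The image of `φ`. -/
abbrev target : Set X := φ.toPartialEquiv.target

/-- For a relation `S` on the domain of `φ`, the relation `φ S φ⁻¹` on the image of `φ`. -/
def conj (S : φ.source → φ.source → Prop) (y y' : φ.target) : Prop :=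
  S ⟨φ.toPartialEquiv.symm y, φ.toPartialEquiv.map_target y.2⟩
    ⟨φ.toPartialEquiv.symm y', φ.toPartialEquiv.map_target y'.2⟩

end FullPseudogroup

end Actions

/-! ### Graphs of relations -/

/-- A graph of relations: a countable graph, a Borel equivalence relation on a standard Borel space
for each vertex and each edge, the same for an edge and its opposite, and for each edge `a` an
injective morphism from the relation carried by `a` to the relation carried by `ter a`. -/
structure GraphOfRelations where
  Vert : Type
  Edge : Type
  [countable_vert : Countable Vert]
  [countable_edge : Countable Edge]
  graph : SerreGraph Vert Edge
  vRel : Vert → BorelRelSpace.{u}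
  eRel : Edge → BorelRelSpace.{u}
  eRel_inv : ∀ a, eRel (graph.inv a) = eRel a
  mor : ∀ a, (eRel a).carrier → (vRel (graph.ter a)).carrier
  measurable_mor : ∀ a, Measurable (mor a)
  injective_mor : ∀ a, Function.Injective (mor a)
  mor_rel : ∀ a e e', (eRel a).rel.toSetoid e e' →
    (vRel (graph.ter a)).rel.toSetoid (mor a e) (mor a e')

namespace GraphOfRelations

variable (G : GraphOfRelations.{u})

/-- The disjoint union of the Borel spaces carried by the vertices. -/
abbrev TotV : Type u := Σ P : G.Vert, (G.vRel P).carrier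

/-- The disjoint union of the Borel spaces carried by the edges. -/
abbrev TotE : Type u := Σ a : G.Edge, (G.eRel a).carrier

/-- A point `e` of the space of `a`, seen in the (equal) space of the opposite of `a`. -/
def flip (e : G.TotE) : G.TotE :=
  ⟨G.graph.inv e.1, cast (congrArg BorelRelSpace.carrier (G.eRel_inv e.1).symm) e.2⟩

/-- The image of a point of the space of `a` by the injective morphism attached to `a`; it lies in
the space of the terminus of `a`. -/
def ter (e : G.TotE) : G.TotV := ⟨G.graph.ter e.1, G.mor e.1 e.2⟩

/-- The image of a point of the space of `a` by the injective morphism attached to the opposite of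
`a`; it lies in the space of the origin of `a`. -/
def org (e : G.TotE) : G.TotV := G.ter (G.flip e)

/-- Being joined by the partial isomorphism `org e ↦ ter e` carried by an edge of `T`. -/
def Step (T : Set G.Edge) (p q : G.TotV) : Prop :=
  ∃ e : G.TotE, e.1 ∈ T ∧ G.org e = p ∧ G.ter e = q

/-- A rooted maximal subtree: a subtree containing all vertices, and a vertex
(the root) such that the space it carries is a fundamental domain of the equivalence relation
generated, on the disjoint union of the vertex spaces, by the partial isomorphisms carried by the
edges of the subtree. -/
structure RootedMaximalTree where
  edges : Set G.Edge
  inv_mem : ∀ a ∈ edges, G.graph.inv a ∈ edges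
  isTree : (G.graph.restrictEdges edges inv_mem).IsTree
  root : G.Vert
  root_fundamental : ∀ p : G.TotV,
    ∃! y : (G.vRel root).carrier, Relation.EqvGen (G.Step edges) ⟨root, y⟩ p

end GraphOfRelations

/-! ### Representations and desingularizations -/

section Desingularizations

variable {X : Type u} [MeasurableSpace X] {R : BorelEqRel X}
  {V : Type v} {E : Type w} [MeasurableSpace V] [MeasurableSpace E]

/-- A representation in `A` of the rooted tree of relations induced by `G` on `T`. The rooted tree
defines an arboretum over the space `Y` of its root: its vertices are the points of the vertex
spaces, each lying over the point of `Y` in its class, and its edges are the points of the spaces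
of the edges of `T`. A representation is an isomorphism `base` of `Y` with a Borel
subset of `X` and an injective morphism of fields of graphs (`onV`, `onE`) over `base`
from this arboretum to `A`, identifying the carried relations with the restrictions of the orbit
relations. -/
structure TreeRepresentation {G : GraphOfRelations.{u}} (T : G.RootedMaximalTree)
    (A : BorelGraphField R V E) where
  base : (G.vRel T.root).carrier → X
  base_embedding : MeasurableEmbedding base
  onV : G.TotV → V
  onE : {e : G.TotE // e.1 ∈ T.edges} → E
  measurable_onV : Measurable onV
  measurable_onE : Measurable onE
  injective_onV : Function.Injective onV
  injective_onE : Function.Injective onE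
  proj_onV : ∀ y p, Relation.EqvGen (G.Step T.edges) ⟨T.root, y⟩ p → A.vert.proj (onV p) = base y
  org_onE : ∀ e, A.graph.org (onE e) = onV (G.org e.1)
  ter_onE : ∀ e, A.graph.ter (onE e) = onV (G.ter e.1)
  inv_onE : ∀ e, A.graph.inv (onE e) = onE ⟨G.flip e.1, T.inv_mem e.1.1 e.2⟩
  vRel_iff : ∀ P p q, (G.vRel P).rel.toSetoid p q ↔ A.vert.OrbitRel (onV ⟨P, p⟩) (onV ⟨P, q⟩)
  eRel_iff : ∀ a (ha : a ∈ T.edges) e e', (G.eRel a).rel.toSetoid e e' ↔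
    A.edge.OrbitRel (onE ⟨⟨a, e⟩, ha⟩) (onE ⟨⟨a, e'⟩, ha⟩)

namespace TreeRepresentation

variable {G : GraphOfRelations.{u}} {T : G.RootedMaximalTree} {A : BorelGraphField R V E}
  (χ : TreeRepresentation T A)

/-- The representation in `A` of the space carried by the vertex `P`. -/
def vertRep (P : G.Vert) : Set V := Set.range fun p : (G.vRel P).carrier => χ.onV ⟨P, p⟩

/-- The representation in `A` of the space carried by the edge `a` of the tree. -/
def edgeRep (a : T.edges) : Set E :=
  Set.range fun e : (G.eRel a).carrier => χ.onE ⟨⟨a, e⟩, a.2⟩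

/-- The identification, through `χ`, of the points of the vertex spaces with points of `X`. -/
def toBase (p : G.TotV) : X := A.vert.proj (χ.onV p)

/-- `G`, `T` and `χ` form an arboretum of representatives: the saturations of the representations
of the vertex spaces form a partition of the vertex space of `A`. -/
def IsArboretumOfRepresentatives : Prop :=
  IsPartitionFamily fun P : G.Vert => A.vert.saturation (χ.vertRep P)

end TreeRepresentation

/-- `f` induces an isomorphism from (the image under an injective map of) the relation carried by
`C` onto the relation `S` on the subset `D` of `X`. -/
def InducesIso (C : BorelRelSpace.{u}) (f : C.carrier → X) (D : Set X) (S : D → D → Prop) : Prop :=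
  Function.Injective f ∧ Set.range f = D ∧
  ∀ e e' (h : f e ∈ D) (h' : f e' ∈ D), C.rel.toSetoid e e' ↔ S ⟨f e, h⟩ ⟨f e', h'⟩

/-- A desingularization of the action of `R` on `A`. -/
structure Desingularization (A : BorelGraphField R V E) where
  G : GraphOfRelations.{u}
  /-- the orientation of the graph underlying `G` -/
  orientation : Set G.Edge
  orientation_iff : ∀ a, a ∈ orientation ↔ G.graph.inv a ∉ orientation
  T : G.RootedMaximalTree
  χ : TreeRepresentation T A
  representatives : χ.IsArboretumOfRepresentatives
  /-- the space carried by the root is identified with `X` -/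
  base_surjective : Function.Surjective χ.base
  /-- the partial isomorphisms carried by the oriented edges outside the tree -/
  φ : {a : G.Edge // a ∈ orientation ∧ a ∉ T.edges} → FullPseudogroup R
  /-- the partial sections of edges of `A` -/
  s : ∀ a, (φ a).source → E
  measurable_s : ∀ a, Measurable (s a)
  proj_s : ∀ a x, A.edge.proj (s a x) = x
  org_s : ∀ a x, A.graph.org (s a x) ∈ χ.vertRep (G.graph.org a.1)
  ter_s : ∀ a (x : (φ a).source),
    ∃ h : R.toSetoid ((φ a).toPartialEquiv x) (A.vert.proj (A.graph.ter (s a x))),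
      A.vert.act ((φ a).toPartialEquiv x) (A.graph.ter (s a x)) h ∈ χ.vertRep (G.graph.ter a.1)
  iso_org : ∀ a, InducesIso (G.eRel a.1) (fun e => χ.toBase (G.org ⟨a.1, e⟩)) (φ a).source
    (fun x y => A.edge.OrbitRel (s a x) (s a y))
  iso_ter : ∀ a, InducesIso (G.eRel a.1) (fun e => χ.toBase (G.ter ⟨a.1, e⟩)) (φ a).target
    ((φ a).conj fun x y => A.edge.OrbitRel (s a x) (s a y))
  /-- the two identifications of the space of `a` correspond to each other under `φ a` -/
  φ_org : ∀ a e, (φ a).toPartialEquiv (χ.toBase (G.org ⟨a.1, e⟩)) = χ.toBase (G.ter ⟨a.1, e⟩)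
  /-- the represented edges are the edges of the tree (in both directions) and the oriented edges
  outside the tree -/
  edge_partition : IsPartitionFamily
    (Sum.elim (fun a : T.edges => A.edge.saturation (χ.edgeRep a))
      (fun a => A.edge.saturation (Set.range (s a))))

end Desingularizations

/-!
Each fibre `A_x` contains a subtree which meets every orbit of vertices exactly once. These subtrees
can be chosen in a Borel way: by the Lusin–Novikov theorem all the edges of `A` lie on countably
many Borel partial sections, and at each stage one of them is attached to one of the sections of
vertices already built, over the set of points at which its terminus lies in a new orbit. If an
orbit of vertices were missed, then, as the fibres are connected, some edge would lead from a
reached orbit to a missed one; its translate into the part already built would have been attached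
at some stage, a contradiction. The sections of vertices are the vertices of the quotient graph,
and the edges attached in the construction form its maximal subtree. The remaining orbits of edges
are exhausted by countably many partial sections `s` which start in a section of vertices, together
with a choice of an element in the orbit of the terminus of `s x` in another section; this choice
defines the element `φ` of the full pseudogroup.
-/

section LusinNovikov

open Set MeasureTheory Topology Filter

variable {A : Type u} {X : Type v}

/-- `S` is a countable union of Borel sets on each of which `f` is injective. By the Lusin–Novikov
theorem `isSigmaInjOn_of_countable_fiber`, these include all Borel sets on which `f` has countable
fibres. -/
def IsSigmaInjOn [MeasurableSpace A] (f : A → X) (S : Set A) : Prop :=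
  ∃ C : ℕ → Set A, (∀ n, MeasurableSet (C n)) ∧ (∀ n, InjOn f (C n)) ∧ S = ⋃ n, C n

namespace IsSigmaInjOn

variable [MeasurableSpace A] {f : A → X}

theorem of_injOn {S : Set A} (hS : MeasurableSet S) (h : InjOn f S) : IsSigmaInjOn f S :=
  ⟨fun _ => S, fun _ => hS, fun _ => h, (iUnion_const S).symm⟩

theorem measurableSet {S : Set A} (h : IsSigmaInjOn f S) : MeasurableSet S := by
  obtain ⟨C, hC, -, rfl⟩ := h
  exact MeasurableSet.iUnion hC

theorem iUnion {ι : Type*} [Countable ι] {S : ι → Set A} (h : ∀ i, IsSigmaInjOn f (S i)) :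
    IsSigmaInjOn f (⋃ i, S i) := by
  cases isEmpty_or_nonempty ι with
  | inl _ => simpa using of_injOn MeasurableSet.empty (injOn_empty f)
  | inr _ =>
    choose C hC hinj hS using h
    obtain ⟨e, he⟩ := exists_surjective_nat (ι × ℕ)
    refine ⟨fun n => C (e n).1 (e n).2, fun n => hC _ _, fun n => hinj _ _, ?_⟩
    rw [he.iUnion_comp fun p => C p.1 p.2, iUnion_prod']
    exact iUnion_congr hS

theorem union {S T : Set A} (hS : IsSigmaInjOn f S) (hT : IsSigmaInjOn f T) :
    IsSigmaInjOn f (S ∪ T) := by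
  rw [union_eq_iUnion]
  exact iUnion (Bool.forall_bool.2 ⟨hT, hS⟩)

end IsSigmaInjOn

theorem exists_measurableSet_superset_injOn [TopologicalSpace A] [PolishSpace A]
    [MeasurableSpace A] [BorelSpace A] [TopologicalSpace X] [T2Space X] [MeasurableSpace X]
    [BorelSpace X] {f : A → X} (hf : Continuous f) {S : Set A} (hS : AnalyticSet S)
    (hfS : InjOn f S) : ∃ C, MeasurableSet C ∧ S ⊆ C ∧ InjOn f C := by
  have hB := TopologicalSpace.isBasis_countableBasis A
  have hsep : ∀ U : TopologicalSpace.countableBasis A,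
      ∃ D, f '' (S ∩ U) ⊆ D ∧ Disjoint (f '' (S ∩ Uᶜ)) D ∧ MeasurableSet D := fun U => by
    have hU : MeasurableSet (U : Set A) := (hB.isOpen U.2).measurableSet
    have hinter : ∀ {T : Set A}, MeasurableSet T → AnalyticSet (f '' (S ∩ T)) := fun hT => by
      rw [inter_eq_iInter]
      exact (AnalyticSet.iInter (Bool.forall_bool.2 ⟨hT.analyticSet, hS⟩)).image_of_continuous hf
    refine (hinter hU).measurablySeparable (hinter hU.compl) ?_
    rw [disjoint_iff_inter_eq_empty, ← hfS.image_inter inter_subset_left inter_subset_left]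
    simp [← inter_inter_distrib_left]
  choose D hUD hDU hD using hsep
  refine ⟨⋂ U : TopologicalSpace.countableBasis A, {a | a ∈ (U : Set A) ↔ f a ∈ D U},
    MeasurableSet.iInter fun U => ?_,
    fun a ha => mem_iInter.2 fun U => ⟨fun haU => ?_, fun haD => ?_⟩,
    fun a ha b hb hab => hB.eq_iff.2 fun U hU => ?_⟩
  · exact ((hB.isOpen U.2).measurableSet.mem.iff (hf.measurable (hD U)).mem).setOf
  · exact hUD U (mem_image_of_mem f ⟨ha, haU⟩)
  · by_contra haU
    exact disjoint_left.1 (hDU U) (mem_image_of_mem f ⟨ha, haU⟩) haD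
  · have hFa := mem_iInter.1 ha ⟨U, hU⟩
    have hFb := mem_iInter.1 hb ⟨U, hU⟩
    simp only [mem_ofPred_eq] at hFa hFb
    rw [hFa, hFb, hab]

/-- The sequences of points of `B` lying in a single fibre of `f`. -/
def fiberSequences (f : A → X) (B : Set A) : Set (ℕ → A) :=
  {z | (∀ i, z i ∈ B) ∧ ∀ i j, f (z i) = f (z j)}

theorem fiberSequences_mono (f : A → X) {B B' : Set A} (h : B ⊆ B') :
    fiberSequences f B ⊆ fiberSequences f B' :=
  fun _ hz => ⟨fun i => h (hz.1 i), hz.2⟩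

theorem measurableSet_fiberSequences [MeasurableSpace A] [MeasurableSpace X] [MeasurableEq X]
    {f : A → X} (hf : Measurable f) {B : Set A} (hB : MeasurableSet B) :
    MeasurableSet (fiberSequences f B) := by
  simp only [fiberSequences, ofPred_and, ofPred_forall]
  exact (MeasurableSet.iInter fun i => measurable_pi_apply i hB).inter
    (MeasurableSet.iInter fun i => MeasurableSet.iInter fun j =>
      measurableSet_eq_fun (hf.comp (measurable_pi_apply i)) (hf.comp (measurable_pi_apply j)))

/-- `B` is Borel, and no property of the sequences in `fiberSequences f B` that is open and
possible can be destroyed by removing from `B` a Borel set on which `f` is injective. -/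
structure IsFiberStable [TopologicalSpace A] [MeasurableSpace A] (f : A → X) (B : Set A) :
    Prop where
  measurableSet : MeasurableSet B
  inter_nonempty : ∀ W : Set (ℕ → A), IsOpen W → (W ∩ fiberSequences f B).Nonempty →
    ∀ C, MeasurableSet C → InjOn f C → (W ∩ fiberSequences f (B \ C)).Nonempty

theorem exists_isFiberStable [TopologicalSpace A] [SecondCountableTopology A] [MeasurableSpace A]
    {f : A → X} (h : ¬ IsSigmaInjOn f univ) : ∃ B, B.Nonempty ∧ IsFiberStable f B := by
  have hB := TopologicalSpace.isBasis_countableBasis (ℕ → A)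
  have hex : ∀ U : TopologicalSpace.countableBasis (ℕ → A), ∃ C, IsSigmaInjOn f C ∧
      ∀ C', IsSigmaInjOn f C' → Disjoint (U : Set (ℕ → A)) (fiberSequences f C'ᶜ) →
        Disjoint (U : Set (ℕ → A)) (fiberSequences f Cᶜ) := fun U => by
    by_cases hU : ∃ C, IsSigmaInjOn f C ∧ Disjoint (U : Set (ℕ → A)) (fiberSequences f Cᶜ)
    · obtain ⟨C, hC, hUC⟩ := hU
      exact ⟨C, hC, fun _ _ _ => hUC⟩
    · exact ⟨∅, .of_injOn MeasurableSet.empty (injOn_empty f),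
        fun C' hC' hUC' => (hU ⟨C', hC', hUC'⟩).elim⟩
  choose C hC hmin using hex
  have hunion : IsSigmaInjOn f (⋃ U, C U) := .iUnion hC
  refine ⟨(⋃ U, C U)ᶜ, ?_, hunion.measurableSet.compl, fun W hW ⟨z, hzW, hz⟩ C' hC' hfC' => ?_⟩
  · rw [nonempty_compl]
    exact fun h' => h (h' ▸ hunion)
  · by_contra hne
    obtain ⟨U, hU, hzU, hUW⟩ := hB.exists_subset_of_mem_open hzW hW
    refine disjoint_left.1 (hmin ⟨U, hU⟩ _ (hunion.union (.of_injOn hC' hfC')) ?_) hzU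
      (fiberSequences_mono f (compl_subset_compl.2 (subset_iUnion C ⟨U, hU⟩)) hz)
    rw [compl_union, ← sdiff_eq]
    exact (disjoint_iff_inter_eq_empty.2 (not_nonempty_iff_eq_empty.1 hne)).mono_left hUW

namespace IsFiberStable

variable {f : A → X} {B : Set A}

theorem exists_apply_ne [TopologicalSpace A] [PolishSpace A] [MeasurableSpace A] [BorelSpace A]
    [TopologicalSpace X] [T2Space X] [SecondCountableTopology X] [MeasurableSpace X] [BorelSpace X]
    (hB : IsFiberStable f B) (hf : Continuous f) {W : Set (ℕ → A)} (hW : IsOpen W)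
    (hne : (W ∩ fiberSequences f B).Nonempty) (i : ℕ) :
    ∃ z ∈ W ∩ fiberSequences f B, ∃ z' ∈ W ∩ fiberSequences f B,
      z i ≠ z' i ∧ f (z i) = f (z' i) := by
  by_contra! h
  have han : AnalyticSet ((fun z => z i) '' (W ∩ fiberSequences f B)) :=
    (hW.measurableSet.inter (measurableSet_fiberSequences hf.measurable
      hB.measurableSet)).analyticSet_image (measurable_pi_apply i)
  have hinj : InjOn f ((fun z => z i) '' (W ∩ fiberSequences f B)) := by
    rintro _ ⟨z, hz, rfl⟩ _ ⟨z', hz', rfl⟩ hzz'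
    by_contra hne
    exact h z hz z' hz' hne hzz'
  obtain ⟨C, hC, hsub, hfC⟩ := exists_measurableSet_superset_injOn hf han hinj
  obtain ⟨z, hzW, hz⟩ := hB.inter_nonempty W hW hne C hC hfC
  exact (hz.1 i).2 (hsub ⟨z, ⟨hzW, fiberSequences_mono f sdiff_subset hz⟩, rfl⟩)

/-- The key to the Baire category argument: the `i`-th term of a sequence can be accompanied by a
nearby distinct term, stored in a coordinate which the given open set does not control. -/
theorem exists_dist_lt [MetricSpace A] [PolishSpace A] [MeasurableSpace A] [BorelSpace A]
    [TopologicalSpace X] [T2Space X] [SecondCountableTopology X] [MeasurableSpace X] [BorelSpace X]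
    (hB : IsFiberStable f B) (hf : Continuous f) {W : Set (ℕ → A)} (hW : IsOpen W)
    (hne : (W ∩ fiberSequences f B).Nonempty) (i : ℕ) {ε : ℝ} (hε : 0 < ε) :
    ∃ z ∈ W ∩ fiberSequences f B, ∃ j, z j ≠ z i ∧ dist (z j) (z i) < ε := by
  obtain ⟨z, hzW, hz⟩ := hne
  obtain ⟨I, U, hU, hIW⟩ := isOpen_pi_iff.1 hW z hzW
  have hWopen : IsOpen ((I : Set ℕ).pi U ∩ {y | dist (y i) (z i) < ε / 2}) :=
    (isOpen_set_pi I.finite_toSet fun k hk => (hU k hk).1).inter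
      (isOpen_lt ((continuous_apply i).dist continuous_const) continuous_const)
  have hmem : z ∈ (I : Set ℕ).pi U ∩ {y | dist (y i) (z i) < ε / 2} :=
    ⟨fun k hk => (hU k hk).2, by simpa using hε⟩
  obtain ⟨y, ⟨⟨hyU, hyz⟩, hy⟩, y', ⟨⟨-, hyz'⟩, hy'⟩, hyy', hfy⟩ :=
    hB.exists_apply_ne hf hWopen ⟨z, hmem, hz⟩ i
  obtain ⟨j, hj⟩ := Infinite.exists_notMem_finset (insert i I)
  rw [Finset.mem_insert, not_or] at hj
  have hval : ∀ k, Function.update y j (y' i) k = y k ∨ Function.update y j (y' i) k = y' i := by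
    intro k
    rcases eq_or_ne k j with rfl | hk
    · exact .inr (Function.update_self ..)
    · exact .inl (Function.update_of_ne hk ..)
  have hfval : ∀ k, f (Function.update y j (y' i) k) = f (y i) := fun k => by
    rcases hval k with h | h <;> rw [h]
    exacts [hy.2 k i, hfy.symm]
  refine ⟨Function.update y j (y' i), ⟨hIW fun k hk => ?_, fun k => ?_, fun k l => ?_⟩, j, ?_⟩
  · rw [Function.update_of_ne fun hkj : k = j => hj.2 (hkj ▸ hk)]
    exact hyU k hk
  · rcases hval k with h | h <;> rw [h]
    exacts [hy.1 k, hy'.1 i]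
  · rw [hfval, hfval]
  · rw [Function.update_self, Function.update_of_ne (Ne.symm hj.1)]
    refine ⟨hyy'.symm, (dist_triangle_right _ _ (z i)).trans_lt ?_⟩
    linarith [mem_ofPred_eq ▸ hyz, mem_ofPred_eq ▸ hyz']

theorem exists_preperfect_range [MetricSpace A] [CompleteSpace A] [SecondCountableTopology A]
    [MeasurableSpace A] [BorelSpace A]
    [TopologicalSpace X] [T2Space X] [SecondCountableTopology X] [MeasurableSpace X] [BorelSpace X]
    (hB : IsFiberStable f B) (hf : Continuous f) (hne : B.Nonempty) :
    ∃ z : ℕ → A, Preperfect (range z) ∧ ∀ i, f (z i) = f (z 0) := by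
  set L := closure (fiberSequences f B)
  have hL : PolishSpace L := isClosed_closure.polishSpace
  let O (p : ℕ × ℕ) : Set L := {z | ∃ j, z.1 j ≠ z.1 p.1 ∧ dist (z.1 j) (z.1 p.1) < 1 / (p.2 + 1)}
  have happly : ∀ j, Continuous fun z : L => z.1 j := fun j =>
    (continuous_apply j).comp continuous_subtype_val
  have hOopen : ∀ p, IsOpen (O p) := fun p => by
    simp only [O, ofPred_exists]
    exact isOpen_iUnion fun j => (isOpen_ne_fun (happly j) (happly p.1)).inter
      (isOpen_lt ((happly j).dist (happly p.1)) continuous_const)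
  have hOdense : ∀ p, Dense (O p) := fun p => by
    rw [dense_iff_inter_open]
    rintro _ ⟨W, hW, rfl⟩ ⟨⟨z, hzL⟩, hzW⟩
    obtain ⟨y, ⟨hyW, hy⟩, hyj⟩ := hB.exists_dist_lt hf hW (mem_closure_iff.1 hzL W hW hzW) p.1
      (Nat.one_div_pos_of_nat (α := ℝ) (n := p.2))
    exact ⟨⟨y, subset_closure hy⟩, hyW, hyj⟩
  have : Nonempty L := hne.elim fun b hb =>
    ⟨⟨fun _ => b, subset_closure ⟨fun _ => hb, fun _ _ => rfl⟩⟩⟩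
  obtain ⟨⟨z, hzL⟩, hz⟩ := (dense_iInter_of_isOpen hOopen hOdense).nonempty
  refine ⟨z, preperfect_iff_nhds.2 ?_, fun i => ?_⟩
  · rintro _ ⟨i, rfl⟩ U hU
    obtain ⟨ε, hε, hball⟩ := Metric.mem_nhds_iff.1 hU
    obtain ⟨m, hm⟩ := exists_nat_one_div_lt hε
    obtain ⟨j, hne, hj⟩ := mem_iInter.1 hz (i, m)
    exact ⟨z j, ⟨hball (hj.trans hm), mem_range_self j⟩, hne⟩
  · have hclosed : IsClosed {z : ℕ → A | f (z i) = f (z 0)} :=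
      isClosed_eq (hf.comp (continuous_apply i)) (hf.comp (continuous_apply 0))
    exact closure_minimal (fun y hy => hy.2 i 0) hclosed hzL

end IsFiberStable

theorem not_countable_of_perfect [MetricSpace A] [CompleteSpace A] {C : Set A} (hC : Perfect C)
    (hne : C.Nonempty) : ¬ C.Countable := fun hcount => by
  obtain ⟨g, hg, -, hginj⟩ := hC.exists_nat_bool_injection hne
  have : Countable (ℕ → Bool) := by
    have := (hcount.mono hg).to_subtype
    exact (rangeFactorization_injective.2 hginj).countable
  obtain ⟨e, he⟩ := exists_surjective_nat (ℕ → Bool)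
  obtain ⟨n, hn⟩ := he fun k => !e k k
  simpa using congrFun hn n

theorem isSigmaInjOn_univ_of_continuous [TopologicalSpace A] [PolishSpace A] [MeasurableSpace A]
    [BorelSpace A] [TopologicalSpace X] [T2Space X] [SecondCountableTopology X] [MeasurableSpace X]
    [BorelSpace X] {f : A → X} (hf : Continuous f) (hc : ∀ x, (f ⁻¹' {x}).Countable) :
    IsSigmaInjOn f univ := by
  by_contra h
  let _ := TopologicalSpace.upgradeIsCompletelyMetrizable A
  obtain ⟨B, hne, hB⟩ := exists_isFiberStable h
  obtain ⟨z, hz, hfz⟩ := hB.exists_preperfect_range hf hne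
  refine not_countable_of_perfect hz.perfect_closure (range_nonempty z).closure
    ((hc (f (z 0))).mono (closure_minimal ?_ (isClosed_singleton.preimage hf)))
  rintro _ ⟨i, rfl⟩
  exact hfz i

variable [MeasurableSpace A] [StandardBorelSpace A] [MeasurableSpace X] [StandardBorelSpace X]

/-- The proof refines the topology of `S` so that `f` becomes continuous on it. -/
theorem isSigmaInjOn_of_countable_fiber {f : A → X} (hf : Measurable f) {S : Set A}
    (hS : MeasurableSet S) (hc : ∀ x, (S ∩ f ⁻¹' {x}).Countable) : IsSigmaInjOn f S := by
  let _ := upgradeStandardBorel X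
  have : StandardBorelSpace S := hS.standardBorel
  let τ := upgradeStandardBorel S
  obtain ⟨t, ht, hft, hpol⟩ :=
    (hf.comp measurable_subtype_coe : Measurable fun a : S => f a).exists_continuous
  have hborel : @BorelSpace S t _ :=
    ⟨by rw [borel_eq_borel_of_le hpol τ.toPolishSpace ht]; exact τ.toBorelSpace.measurable_eq⟩
  have hfiber : ∀ x, ((fun a : S => f a) ⁻¹' {x}).Countable := fun x =>
    ((hc x).preimage Subtype.val_injective).mono fun a ha => And.intro a.2 ha
  obtain ⟨C, hC, hinj, hunion⟩ :=
    @isSigmaInjOn_univ_of_continuous S X t hpol _ hborel _ _ _ _ _ _ hft hfiber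
  refine ⟨fun n => Subtype.val '' C n, fun n => hS.subtype_image (hC n), fun n => ?_, ?_⟩
  · rintro _ ⟨a, ha, rfl⟩ _ ⟨b, hb, rfl⟩ hab
    exact congrArg _ (hinj n ha hb hab)
  · rw [← image_iUnion, ← hunion, image_univ, Subtype.range_coe]

theorem measurableSet_image_of_countable_fiber {f : A → X} (hf : Measurable f) {S : Set A}
    (hS : MeasurableSet S) (hc : ∀ x, (S ∩ f ⁻¹' {x}).Countable) : MeasurableSet (f '' S) := by
  obtain ⟨C, hC, hinj, rfl⟩ := isSigmaInjOn_of_countable_fiber hf hS hc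
  rw [image_iUnion]
  exact MeasurableSet.iUnion fun n => (hC n).image_of_measurable_injOn hf (hinj n)

theorem exists_iUnion_injOn_injOn {Y : Type w} [MeasurableSpace Y] [StandardBorelSpace Y]
    {f : A → X} {g : A → Y} (hf : Measurable f) (hg : Measurable g) {S : Set A}
    (hS : MeasurableSet S) (hfc : ∀ x, (S ∩ f ⁻¹' {x}).Countable)
    (hgc : ∀ y, (S ∩ g ⁻¹' {y}).Countable) :
    ∃ C : ℕ → Set A, (∀ n, MeasurableSet (C n)) ∧ (∀ n, InjOn f (C n)) ∧ (∀ n, InjOn g (C n)) ∧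
      S = ⋃ n, C n := by
  obtain ⟨C, hC, hCf, hSC⟩ := isSigmaInjOn_of_countable_fiber hf hS hfc
  obtain ⟨D, hD, hDg, hSD⟩ := isSigmaInjOn_of_countable_fiber hg hS hgc
  refine ⟨fun n => C n.unpair.1 ∩ D n.unpair.2, fun n => (hC _).inter (hD _),
    fun n => (hCf _).mono inter_subset_left, fun n => (hDg _).mono inter_subset_right, ?_⟩
  rw [iUnion_unpair fun m n => C m ∩ D n, ← iUnion_inter_iUnion, ← hSC, ← hSD, inter_self]

theorem exists_measurable_inverse_of_injOn {f : A → X} (hf : Measurable f) {S : Set A}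
    (hS : MeasurableSet S) (hinj : InjOn f S) :
    ∃ g : f '' S → A, Measurable g ∧ ∀ x, g x ∈ S ∧ f (g x) = x := by
  choose g hgS hfg using fun x : f '' S => x.2
  refine ⟨g, fun T hT => ?_, fun x => ⟨hgS x, hfg x⟩⟩
  have himage : g ⁻¹' T = Subtype.val ⁻¹' (f '' (S ∩ T)) := by
    ext x
    refine ⟨fun hx => ⟨g x, ⟨hgS x, hx⟩, hfg x⟩, ?_⟩
    rintro ⟨a, ⟨haS, haT⟩, hax⟩
    rwa [mem_preimage, hinj (hgS x) haS ((hfg x).trans hax.symm)]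
  rw [himage]
  exact measurable_subtype_coe
    ((hS.inter hT).image_of_measurable_injOn hf (hinj.mono inter_subset_left))

end LusinNovikov

section Relations

open Set MeasureTheory

theorem measurable_of_measurable_sigma {ι : Type*} {β : ι → Type*} [∀ i, MeasurableSpace (β i)]
    {Z : Type*} [MeasurableSpace Z] {f : (Σ i, β i) → Z}
    (h : ∀ i, Measurable fun b => f ⟨i, b⟩) : Measurable f :=
  fun _ hs => MeasurableSpace.measurableSet_iInf.2 fun i => h i hs

/-- The relation induced on `Y` by an injective Borel map to `F`. -/
def BorelEqRel.comap {F : Type u} [MeasurableSpace F] (Q : BorelEqRel F) {Y : Type v}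
    [MeasurableSpace Y] (g : Y → F) (hg : Measurable g) (hinj : Function.Injective g) :
    BorelEqRel Y where
  toSetoid := Q.toSetoid.comap g
  measurableSet_graph := (hg.prodMap hg) Q.measurableSet_graph
  countable_class y := (Q.countable_class (g y)).preimage hinj

namespace FiberedAction

variable {X : Type u} [MeasurableSpace X] {R : BorelEqRel X} {F : Type v} [MeasurableSpace F]
  {F' : Type w} [MeasurableSpace F'] (Φ : FiberedAction R F) {Φ' : FiberedAction R F'}

theorem act_congr {x x' : X} {t t' : F} (hx : x = x') (ht : t = t')
    (h : R.toSetoid x (Φ.proj t)) (h' : R.toSetoid x' (Φ.proj t')) :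
    Φ.act x t h = Φ.act x' t' h' := by
  subst hx ht
  rfl

theorem orbitRel_act (x : X) (t : F) (h : R.toSetoid x (Φ.proj t)) :
    Φ.OrbitRel (Φ.act x t h) t :=
  ⟨(Φ.proj_act x t h).symm ▸ h, Φ.act_congr (Φ.proj_act x t h) rfl _ _⟩

theorem OrbitRel.refl (f : F) : Φ.OrbitRel f f := ⟨R.toSetoid.refl _, Φ.act_self f⟩

variable {Φ}

theorem OrbitRel.of_eq {f f' : F} (h : f = f') : Φ.OrbitRel f f' := h ▸ .refl Φ f

theorem OrbitRel.symm {f f' : F} (h : Φ.OrbitRel f f') : Φ.OrbitRel f' f := by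
  obtain ⟨h, hf⟩ := h
  have h' := R.toSetoid.symm h
  refine ⟨h', ?_⟩
  calc Φ.act (Φ.proj f') f h'
      = Φ.act (Φ.proj f') (Φ.act (Φ.proj f) f' h) ((Φ.proj_act _ _ h).symm ▸ h') :=
        Φ.act_congr rfl hf.symm _ _
    _ = Φ.act (Φ.proj f') f' (R.toSetoid.refl _) := Φ.act_act _ _ f' h' h
    _ = f' := Φ.act_self f'

theorem OrbitRel.trans {f g k : F} (h : Φ.OrbitRel f g) (h' : Φ.OrbitRel g k) :
    Φ.OrbitRel f k := by
  obtain ⟨h, hf⟩ := h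
  obtain ⟨h', hg⟩ := h'
  refine ⟨R.toSetoid.trans h h', ?_⟩
  calc Φ.act (Φ.proj f) k (R.toSetoid.trans h h')
      = Φ.act (Φ.proj f) (Φ.act (Φ.proj g) k h') ((Φ.proj_act _ _ h').symm ▸ h) :=
        (Φ.act_act _ _ k h h').symm
    _ = Φ.act (Φ.proj f) g h := Φ.act_congr rfl hg _ _
    _ = f := hf

theorem OrbitRel.rel {f g : F} (h : Φ.OrbitRel f g) : R.toSetoid (Φ.proj f) (Φ.proj g) := h.1

theorem measurableSet_orbitRel [StandardBorelSpace F] :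
    MeasurableSet {p : F × F | Φ.OrbitRel p.1 p.2} := by
  let D : Set (F × F) := {p | R.toSetoid (Φ.proj p.1) (Φ.proj p.2)}
  have hD : MeasurableSet D :=
    (Φ.measurable_proj.prodMap Φ.measurable_proj) R.measurableSet_graph
  have hact : Measurable fun p : D => Φ.act (Φ.proj p.1.1) p.1.2 p.2 :=
    Φ.measurable_act.comp (f := fun p : D =>
      (⟨(Φ.proj p.1.1, p.1.2), p.2⟩ : {q : X × F // R.toSetoid q.1 (Φ.proj q.2)}))
      (((Φ.measurable_proj.prodMap measurable_id).comp measurable_subtype_coe).subtype_mk)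
  have himage : {p : F × F | Φ.OrbitRel p.1 p.2} =
      Subtype.val '' {p : D | Φ.act (Φ.proj p.1.1) p.1.2 p.2 = p.1.1} := by
    ext p
    exact ⟨fun ⟨h, hp⟩ => ⟨⟨p, h⟩, hp, rfl⟩, by rintro ⟨⟨p, h⟩, hp, rfl⟩; exact ⟨h, hp⟩⟩
  rw [himage]
  exact hD.subtype_image
    (measurableSet_eq_fun hact (measurable_fst.comp measurable_subtype_coe))

variable (Φ)

theorem countable_preimage_class (x : X) : {f | R.toSetoid x (Φ.proj f)}.Countable :=
  ((R.countable_class x).biUnion fun y _ => Φ.countable_fiber y).mono fun f hf =>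
    mem_biUnion (x := Φ.proj f) hf rfl

/-- The orbit equivalence relation as a Borel equivalence relation with countable classes. -/
def orbit [StandardBorelSpace F] : BorelEqRel F where
  toSetoid := ⟨Φ.OrbitRel, OrbitRel.refl Φ, OrbitRel.symm, OrbitRel.trans⟩
  measurableSet_graph := measurableSet_orbitRel
  countable_class f := (Φ.countable_preimage_class (Φ.proj f)).mono fun _ h => OrbitRel.rel h

theorem measurableSet_saturation [StandardBorelSpace F] {S : Set F} (hS : MeasurableSet S) :
    MeasurableSet (Φ.saturation S) := by
  have himage : Φ.saturation S =
      Prod.fst '' ({p : F × F | Φ.OrbitRel p.1 p.2} ∩ Prod.snd ⁻¹' S) := by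
    ext f
    exact ⟨fun ⟨f', hf', h⟩ => ⟨(f, f'), ⟨h, hf'⟩, rfl⟩,
      by rintro ⟨⟨f, f'⟩, ⟨h, hf'⟩, rfl⟩; exact ⟨f', hf', h⟩⟩
  rw [himage]
  refine measurableSet_image_of_countable_fiber measurable_fst
    (measurableSet_orbitRel.inter (measurable_snd hS)) fun f => ?_
  refine ((Φ.orbit.countable_class f).image (Prod.mk f)).mono ?_
  rintro ⟨f, f'⟩ ⟨⟨h, -⟩, rfl⟩
  exact ⟨f', h, rfl⟩

theorem subset_saturation (S : Set F) : S ⊆ Φ.saturation S := fun f hf => ⟨f, hf, .refl Φ f⟩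

variable {Φ}

theorem OrbitRel.mem_saturation_iff {f g : F} (h : Φ.OrbitRel f g) {S : Set F} :
    f ∈ Φ.saturation S ↔ g ∈ Φ.saturation S :=
  ⟨fun ⟨k, hk, hfk⟩ => ⟨k, hk, h.symm.trans hfk⟩, fun ⟨k, hk, hgk⟩ => ⟨k, hk, h.trans hgk⟩⟩

theorem isPartitionFamily_saturation {ι : Type*} {S : ι → Set F} (hne : ∀ i, (S i).Nonempty)
    (hinj : ∀ i j, ∀ f ∈ S i, ∀ g ∈ S j, Φ.OrbitRel f g → i = j)
    (hcover : ∀ f, ∃ i, ∃ g ∈ S i, Φ.OrbitRel f g) :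
    IsPartitionFamily fun i => Φ.saturation (S i) := by
  refine ⟨fun i => (hne i).mono (Φ.subset_saturation _), fun i j hij => ?_, ?_⟩
  · refine disjoint_left.2 fun h hi hj => hij ?_
    obtain ⟨f, hf, hhf⟩ := hi
    obtain ⟨g, hg, hhg⟩ := hj
    exact hinj i j f hf g hg (hhf.symm.trans hhg)
  · exact eq_univ_of_forall fun f => mem_iUnion.2 (hcover f)

theorem IsMorphism.orbitRel {m : F → F'} (hm : Φ.IsMorphism Φ' m) {f g : F}
    (h : Φ.OrbitRel f g) : Φ'.OrbitRel (m f) (m g) := by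
  obtain ⟨h, hf⟩ := h
  have h' : R.toSetoid (Φ.proj f) (Φ'.proj (m g)) := (hm.proj_map g).symm ▸ h
  have hmf : Φ'.act (Φ.proj f) (m g) h' = m f := by rw [← hm.map_act _ _ h, hf]
  exact hmf ▸ Φ'.orbitRel_act (Φ.proj f) (m g) h'

theorem IsMorphism.exists_lift {m : F → F'} (hm : Φ.IsMorphism Φ' m) {g : F} {y : F'}
    (h : Φ'.OrbitRel y (m g)) : ∃ f, Φ.OrbitRel f g ∧ m f = y := by
  obtain ⟨h, hy⟩ := h
  have h' : R.toSetoid (Φ'.proj y) (Φ.proj g) := hm.proj_map g ▸ h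
  exact ⟨Φ.act (Φ'.proj y) g h', Φ.orbitRel_act _ _ _, by rw [hm.map_act, hy]⟩

end FiberedAction

theorem exists_fullPseudogroup_of_injOn {X : Type u} [MeasurableSpace X] [StandardBorelSpace X]
    (R : BorelEqRel X) {Z : Type v} [MeasurableSpace Z] [StandardBorelSpace Z] {p q : Z → X}
    (hp : Measurable p) (hq : Measurable q) {S : Set Z} (hS : MeasurableSet S) (hpS : InjOn p S)
    (hqS : InjOn q S) (hR : ∀ z ∈ S, R.toSetoid (q z) (p z)) :
    ∃ (φ : FullPseudogroup R) (s : φ.source → Z), Measurable s ∧ range s = S ∧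
      ∀ x, p (s x) = x ∧ q (s x) = φ.toPartialEquiv x := by
  rcases S.eq_empty_or_nonempty with rfl | ⟨z₀, -⟩
  · let φ : FullPseudogroup R := ⟨.ofSet ∅, .empty, .empty, measurable_subtype_coe,
      measurable_subtype_coe, fun x hx => hx.elim⟩
    have : IsEmpty φ.source := isEmpty_coe_sort.2 rfl
    exact ⟨φ, isEmptyElim, measurable_of_empty _, range_eq_empty _, isEmptyElim⟩
  have : Nonempty Z := ⟨z₀⟩
  obtain ⟨g, hg, hgS⟩ := exists_measurable_inverse_of_injOn hp hS hpS
  obtain ⟨k, hk, hkS⟩ := exists_measurable_inverse_of_injOn hq hS hqS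
  let φ : PartialEquiv X X := (hpS.toPartialEquiv p S).symm.trans' (hqS.toPartialEquiv q S) rfl
  have hφ : ∀ z ∈ S, φ (p z) = q z := fun z hz => congrArg q (hpS.leftInvOn_invFunOn hz)
  have hφsymm : ∀ z ∈ S, φ.symm (q z) = p z := fun z hz =>
    congrArg p (hqS.leftInvOn_invFunOn hz)
  have hφg : (fun x : p '' S => φ x) = q ∘ g := funext fun x => by
    rw [Function.comp_apply, ← hφ _ (hgS x).1, (hgS x).2]
  have hφk : (fun y : q '' S => φ.symm y) = p ∘ k := funext fun y => by
    rw [Function.comp_apply, ← hφsymm _ (hkS y).1, (hkS y).2]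
  have hrange : range g = S := Subset.antisymm (range_subset_iff.2 fun x => (hgS x).1)
    fun z hz => ⟨⟨p z, z, hz, rfl⟩, hpS (hgS _).1 hz (hgS _).2⟩
  refine ⟨⟨φ, hS.image_of_measurable_injOn hp hpS, hS.image_of_measurable_injOn hq hqS,
    hφg ▸ hq.comp hg, hφk ▸ hp.comp hk, ?_⟩, g, hg, hrange,
    fun x => ⟨(hgS x).2, (congrFun hφg x).symm⟩⟩
  rintro _ ⟨z, hz, rfl⟩
  exact (hφ z hz).symm ▸ hR z hz

end Relations

section Sections

open Set MeasureTheory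

variable {X : Type u} [MeasurableSpace X] {R : BorelEqRel X}

/-- A partial Borel section of the projection of `F` to `X`, encoded by its image: a Borel subset
of `F` which meets each fibre at most once. -/
structure BorelSection {F : Type v} [MeasurableSpace F] (Φ : FiberedAction R F) where
  carrier : Set F
  measurableSet : MeasurableSet carrier
  injOn : InjOn Φ.proj carrier

namespace BorelSection

section

variable {F : Type v} [MeasurableSpace F] {Φ : FiberedAction R F}

instance : SetLike (BorelSection Φ) F where
  coe := carrier
  coe_injective σ τ h := by cases σ; congr

/-- The domain of a partial section. -/
def dom (σ : BorelSection Φ) : Set X := Φ.proj '' σ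

theorem proj_mem_dom {σ : BorelSection Φ} {f : F} (hf : f ∈ σ) : Φ.proj f ∈ σ.dom :=
  mem_image_of_mem _ hf

variable [StandardBorelSpace F]

section Map

variable {F' : Type w} [MeasurableSpace F'] [StandardBorelSpace F'] {Φ' : FiberedAction R F'}

/-- The image of a partial section under a morphism. -/
def map (σ : BorelSection Φ) {m : F → F'} (hm : Φ.IsMorphism Φ' m) : BorelSection Φ' where
  carrier := m '' σ
  measurableSet := σ.measurableSet.image_of_measurable_injOn hm.measurable
    fun f hf g hg hfg => σ.injOn hf hg (by rw [← hm.proj_map, hfg, hm.proj_map])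
  injOn := by
    rintro _ ⟨f, hf, rfl⟩ _ ⟨g, hg, rfl⟩ h
    rw [hm.proj_map, hm.proj_map] at h
    rw [σ.injOn hf hg h]

end Map

variable [StandardBorelSpace X]

theorem measurableSet_dom (σ : BorelSection Φ) : MeasurableSet σ.dom :=
  σ.measurableSet.image_of_measurable_injOn Φ.measurable_proj σ.injOn

/-- The partial section as a function on its domain. -/
noncomputable def toFun (σ : BorelSection Φ) : σ.dom → F :=
  (exists_measurable_inverse_of_injOn Φ.measurable_proj σ.measurableSet σ.injOn).choose

noncomputable instance : CoeFun (BorelSection Φ) fun σ => σ.dom → F := ⟨toFun⟩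

variable (σ : BorelSection Φ)

theorem measurable : Measurable σ :=
  (exists_measurable_inverse_of_injOn Φ.measurable_proj σ.measurableSet σ.injOn).choose_spec.1

theorem apply_mem (x : σ.dom) : σ x ∈ σ :=
  ((exists_measurable_inverse_of_injOn Φ.measurable_proj σ.measurableSet
    σ.injOn).choose_spec.2 x).1

theorem proj_apply (x : σ.dom) : Φ.proj (σ x) = x :=
  ((exists_measurable_inverse_of_injOn Φ.measurable_proj σ.measurableSet
    σ.injOn).choose_spec.2 x).2

variable {σ} in
theorem apply_eq_iff {x : σ.dom} {f : F} (hf : f ∈ σ) : σ x = f ↔ (x : X) = Φ.proj f :=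
  ⟨fun h => h ▸ (σ.proj_apply x).symm, fun h => σ.injOn (σ.apply_mem x) hf (σ.proj_apply x ▸ h)⟩

theorem injective : Function.Injective σ := fun x y h =>
  Subtype.ext (by rw [← σ.proj_apply, h, σ.proj_apply])

/-- The domain of a partial section with the relation induced by the orbit relation. -/
noncomputable def relSpace : BorelRelSpace.{u} where
  carrier := σ.dom
  std := σ.measurableSet_dom.standardBorel
  rel := Φ.orbit.comap σ σ.measurable σ.injective

theorem exists_iUnion_eq_univ (Φ : FiberedAction R F) :
    ∃ σ : ℕ → BorelSection Φ, ⋃ n, (σ n : Set F) = univ := by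
  obtain ⟨C, hC, hinj, hunion⟩ := isSigmaInjOn_of_countable_fiber Φ.measurable_proj
    MeasurableSet.univ fun x => (Φ.countable_fiber x).mono inter_subset_right
  exact ⟨fun n => ⟨C n, hC n, hinj n⟩, hunion.symm⟩

theorem exists_dom_eq_univ (hΦ : Function.Surjective Φ.proj) :
    ∃ σ : BorelSection Φ, σ.dom = univ := by
  obtain ⟨σ, hσ⟩ := exists_iUnion_eq_univ Φ
  let D : ℕ → Set X := disjointed fun n => (σ n).dom
  have hD : ∀ n, MeasurableSet (D n) := fun n => .disjointed (fun n => (σ n).measurableSet_dom) n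
  refine ⟨⟨⋃ n, (σ n : Set F) ∩ Φ.proj ⁻¹' D n,
    .iUnion fun n => (σ n).measurableSet.inter (Φ.measurable_proj (hD n)), ?_⟩, ?_⟩
  · intro f hf g hg hfg
    obtain ⟨m, hfm, hfD⟩ := mem_iUnion.1 hf
    obtain ⟨n, hgn, hgD⟩ := mem_iUnion.1 hg
    obtain rfl : m = n := by
      by_contra hmn
      have hfD' : Φ.proj f ∈ D n := hfg ▸ mem_preimage.1 hgD
      exact disjoint_left.1 (disjoint_disjointed _ hmn) hfD hfD'
    exact (σ m).injOn hfm hgn hfg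
  · refine eq_univ_of_forall fun x => ?_
    obtain ⟨f, rfl⟩ := hΦ x
    have hx : Φ.proj f ∈ ⋃ n, D n := by
      obtain ⟨n, hn⟩ := mem_iUnion.1 (hσ.ge (mem_univ f))
      exact iUnion_disjointed.ge (mem_iUnion.2 ⟨n, proj_mem_dom hn⟩)
    obtain ⟨n, hn⟩ := mem_iUnion.1 hx
    obtain ⟨g, hg, hgf⟩ := disjointed_subset _ n hn
    exact ⟨g, mem_iUnion.2 ⟨n, hg, mem_preimage.2 (hgf ▸ hn)⟩, hgf⟩

end

end BorelSection

variable {V : Type v} {E : Type w} [MeasurableSpace V] [MeasurableSpace E]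
  {A : BorelGraphField R V E}

/-- A partial Borel section of edges of `A` going from the partial section `σ` to the partial
section `σ'` up to the action of `R`, encoded by a Borel set of pairs: if `(e, v)` is such a pair
then `e` starts in `σ` and `v` is a point of `σ'` in the orbit of the terminus of `e`. The
projections to `X` of `e` and `v` correspond to each other under an element of `[[R]]`. -/
structure EdgeSection (σ σ' : BorelSection A.vert) where
  carrier : Set (E × V)
  measurableSet : MeasurableSet carrier
  injOn_fst : InjOn (fun p => A.edge.proj p.1) carrier
  injOn_snd : InjOn (fun p => A.vert.proj p.2) carrier
  org_mem : ∀ p ∈ carrier, A.graph.org p.1 ∈ σ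
  snd_mem : ∀ p ∈ carrier, p.2 ∈ σ'
  orbitRel : ∀ p ∈ carrier, A.vert.OrbitRel p.2 (A.graph.ter p.1)

namespace EdgeSection

variable {σ σ' : BorelSection A.vert}

instance : SetLike (EdgeSection σ σ') (E × V) where
  coe := carrier
  coe_injective τ τ' h := by cases τ; congr

/-- The Borel set of edges of an edge section. -/
def edges (τ : EdgeSection σ σ') : Set E := Prod.fst '' (τ : Set (E × V))

variable (τ : EdgeSection σ σ')

/-- The part of an edge section formed by the edges which belong to `N`. -/
def restrict {N : Set E} (hN : MeasurableSet N) : EdgeSection σ σ' where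
  carrier := τ.carrier ∩ Prod.fst ⁻¹' N
  measurableSet := τ.measurableSet.inter (measurable_fst hN)
  injOn_fst := τ.injOn_fst.mono inter_subset_left
  injOn_snd := τ.injOn_snd.mono inter_subset_left
  org_mem p hp := τ.org_mem p hp.1
  snd_mem p hp := τ.snd_mem p hp.1
  orbitRel p hp := τ.orbitRel p hp.1

variable [StandardBorelSpace V] [StandardBorelSpace E]

theorem measurableSet_edges : MeasurableSet τ.edges :=
  τ.measurableSet.image_of_measurable_injOn measurable_fst
    fun _ hp _ hq h => τ.injOn_fst hp hq (congrArg A.edge.proj h)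

/-- The edge section given by a partial section of edges from `σ` to `σ'`, with the identity of its
domain as element of `[[R]]`. -/
def ofSection (ε : BorelSection A.edge) (horg : ∀ e ∈ ε, A.graph.org e ∈ σ)
    (hter : ∀ e ∈ ε, A.graph.ter e ∈ σ') : EdgeSection σ σ' where
  carrier := (fun e => (e, A.graph.ter e)) '' ε
  measurableSet := ε.measurableSet.image_of_measurable_injOn
    (measurable_id.prodMk A.ter_morphism.measurable) fun _ _ _ _ h => congrArg Prod.fst h
  injOn_fst := by
    rintro _ ⟨e, he, rfl⟩ _ ⟨e', he', rfl⟩ h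
    rw [ε.injOn he he' h]
  injOn_snd := by
    rintro _ ⟨e, he, rfl⟩ _ ⟨e', he', rfl⟩ h
    simp only [A.ter_morphism.proj_map] at h
    rw [ε.injOn he he' h]
  org_mem := forall_mem_image.2 horg
  snd_mem := forall_mem_image.2 hter
  orbitRel := forall_mem_image.2 fun _ _ => .refl _ _

variable [StandardBorelSpace X]

theorem exists_fullPseudogroup : ∃ (φ : FullPseudogroup R) (pair : φ.source → E × V),
    Measurable pair ∧ range pair = τ ∧
      ∀ x, A.edge.proj (pair x).1 = x ∧ A.vert.proj (pair x).2 = φ.toPartialEquiv x :=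
  exists_fullPseudogroup_of_injOn R (A.edge.measurable_proj.comp measurable_fst)
    (A.vert.measurable_proj.comp measurable_snd) τ.measurableSet τ.injOn_fst τ.injOn_snd
    fun p hp => by
      rw [Function.comp_apply, Function.comp_apply, ← A.ter_morphism.proj_map]
      exact (τ.orbitRel p hp).rel

/-- The partial isomorphism which takes the projection of `e` to the projection of `v` for each
pair `(e, v)` of the edge section. -/
noncomputable def φ : FullPseudogroup R := τ.exists_fullPseudogroup.choose

/-- The pair `(e, v)` of the edge section for which `e` lies over a given point. -/
noncomputable def pair : τ.φ.source → E × V := τ.exists_fullPseudogroup.choose_spec.choose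

/-- The edge section as a function. -/
noncomputable def s (x : τ.φ.source) : E := (τ.pair x).1

theorem measurable_pair : Measurable τ.pair := τ.exists_fullPseudogroup.choose_spec.choose_spec.1

theorem range_pair : range τ.pair = τ := τ.exists_fullPseudogroup.choose_spec.choose_spec.2.1

theorem proj_s (x : τ.φ.source) : A.edge.proj (τ.s x) = x :=
  (τ.exists_fullPseudogroup.choose_spec.choose_spec.2.2 x).1

theorem proj_snd_pair (x : τ.φ.source) : A.vert.proj (τ.pair x).2 = τ.φ.toPartialEquiv x :=
  (τ.exists_fullPseudogroup.choose_spec.choose_spec.2.2 x).2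

theorem pair_mem (x : τ.φ.source) : τ.pair x ∈ τ := τ.range_pair.le (mem_range_self x)

theorem measurable_s : Measurable τ.s := measurable_fst.comp τ.measurable_pair

theorem injective_s : Function.Injective τ.s := fun x y h =>
  Subtype.ext (by rw [← τ.proj_s, h, τ.proj_s])

theorem range_s : range τ.s = τ.edges := by
  rw [edges, ← τ.range_pair, ← range_comp]
  rfl

theorem proj_org_s (x : τ.φ.source) : A.vert.proj (A.graph.org (τ.s x)) = x :=
  (A.org_morphism.proj_map _).trans (τ.proj_s x)

/-- The domain of an edge section as a part of the domain of the section in which it starts. -/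
def orgMap (x : τ.φ.source) : σ.dom :=
  ⟨x, τ.proj_org_s x ▸ BorelSection.proj_mem_dom (τ.org_mem _ (τ.pair_mem x))⟩

/-- The identification, by the partial isomorphism `φ`, of the domain of an edge section with a
part of the domain of the section in which it ends. -/
noncomputable def terMap (x : τ.φ.source) : σ'.dom :=
  ⟨τ.φ.toPartialEquiv x,
    τ.proj_snd_pair x ▸ BorelSection.proj_mem_dom (τ.snd_mem _ (τ.pair_mem x))⟩

theorem apply_orgMap (x : τ.φ.source) : σ (τ.orgMap x) = A.graph.org (τ.s x) :=
  (BorelSection.apply_eq_iff (τ.org_mem _ (τ.pair_mem x))).2 (τ.proj_org_s x).symm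

theorem apply_terMap (x : τ.φ.source) : σ' (τ.terMap x) = (τ.pair x).2 :=
  (BorelSection.apply_eq_iff (τ.snd_mem _ (τ.pair_mem x))).2 (τ.proj_snd_pair x).symm

theorem apply_terMap_ofSection {ε : BorelSection A.edge} (horg : ∀ e ∈ ε, A.graph.org e ∈ σ)
    (hter : ∀ e ∈ ε, A.graph.ter e ∈ σ') (x : (ofSection ε horg hter).φ.source) :
    σ' ((ofSection ε horg hter).terMap x) = A.graph.ter ((ofSection ε horg hter).s x) := by
  obtain ⟨e, -, he⟩ := (ofSection ε horg hter).pair_mem x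
  rw [apply_terMap, s, ← he]

theorem range_s_ofSection {ε : BorelSection A.edge} (horg : ∀ e ∈ ε, A.graph.org e ∈ σ)
    (hter : ∀ e ∈ ε, A.graph.ter e ∈ σ') : range (ofSection ε horg hter).s = ε := by
  rw [range_s]
  exact (image_image _ _ _).trans (image_id _)

theorem orbitRel_terMap (x : τ.φ.source) :
    A.vert.OrbitRel (σ' (τ.terMap x)) (A.graph.ter (τ.s x)) :=
  τ.apply_terMap x ▸ τ.orbitRel _ (τ.pair_mem x)

theorem measurable_orgMap : Measurable τ.orgMap := measurable_subtype_coe.subtype_mk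

theorem measurable_terMap : Measurable τ.terMap := τ.φ.measurable_toFun.subtype_mk

theorem injective_orgMap : Function.Injective τ.orgMap := fun _ _ h =>
  Subtype.ext (congrArg (fun z : σ.dom => (z : X)) h :)

theorem injective_terMap : Function.Injective τ.terMap := fun x y h =>
  Subtype.ext (τ.φ.toPartialEquiv.injOn x.2 y.2 (congrArg Subtype.val h))

/-- The domain of an edge section with the relation `Stab(s)` induced by the orbit relation. -/
noncomputable def relSpace : BorelRelSpace.{u} where
  carrier := τ.φ.source
  std := τ.φ.measurableSet_source.standardBorel
  rel := A.edge.orbit.comap τ.s τ.measurable_s τ.injective_s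

theorem orbitRel_apply_orgMap {x y : τ.φ.source} (h : A.edge.OrbitRel (τ.s x) (τ.s y)) :
    A.vert.OrbitRel (σ (τ.orgMap x)) (σ (τ.orgMap y)) := by
  rw [apply_orgMap, apply_orgMap]
  exact A.org_morphism.orbitRel h

theorem orbitRel_apply_terMap {x y : τ.φ.source} (h : A.edge.OrbitRel (τ.s x) (τ.s y)) :
    A.vert.OrbitRel (σ' (τ.terMap x)) (σ' (τ.terMap y)) :=
  ((τ.orbitRel_terMap x).trans (A.ter_morphism.orbitRel h)).trans (τ.orbitRel_terMap y).symm

theorem exists_act_ter_s (x : τ.φ.source) :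
    ∃ h : R.toSetoid (τ.φ.toPartialEquiv x) (A.vert.proj (A.graph.ter (τ.s x))),
      A.vert.act (τ.φ.toPartialEquiv x) (A.graph.ter (τ.s x)) h = σ' (τ.terMap x) := by
  obtain ⟨h, hact⟩ := τ.orbitRel_terMap x
  have hproj : A.vert.proj (σ' (τ.terMap x)) = τ.φ.toPartialEquiv x := BorelSection.proj_apply _ _
  exact ⟨hproj ▸ h, (A.vert.act_congr hproj.symm rfl _ _).trans hact⟩

variable {τ} in
theorem inducesIso_source {f : τ.φ.source → X} (hf : ∀ x, f x = x) :
    InducesIso τ.relSpace f τ.φ.source fun x y => A.edge.OrbitRel (τ.s x) (τ.s y) := by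
  obtain rfl : f = Subtype.val := funext hf
  exact ⟨Subtype.val_injective, Subtype.range_coe, fun _ _ _ _ => Iff.rfl⟩

variable {τ} in
theorem inducesIso_target {f : τ.φ.source → X} (hf : ∀ x, f x = τ.φ.toPartialEquiv x) :
    InducesIso τ.relSpace f τ.φ.target
      (τ.φ.conj fun x y => A.edge.OrbitRel (τ.s x) (τ.s y)) := by
  obtain rfl : f = fun x : τ.φ.source => τ.φ.toPartialEquiv x := funext hf
  refine ⟨fun x y h => Subtype.ext (τ.φ.toPartialEquiv.injOn x.2 y.2 h), ?_, fun x y _ _ => ?_⟩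
  · exact (image_eq_range _ _).symm.trans τ.φ.toPartialEquiv.image_source_eq_target
  · have hsymm : ∀ (z : τ.φ.source) (h : _), z =
        (⟨τ.φ.toPartialEquiv.symm (τ.φ.toPartialEquiv z), h⟩ : τ.φ.source) := fun z _ =>
      Subtype.ext (τ.φ.toPartialEquiv.left_inv z.2).symm
    exact Iff.of_eq (congrArg₂ (fun x y => A.edge.OrbitRel (τ.s x) (τ.s y)) (hsymm x _)
      (hsymm y _))

end EdgeSection

end Sections

section TreeOfSections

open Set MeasureTheory

variable {X : Type u} [MeasurableSpace X] {R : BorelEqRel X}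
  {V : Type v} {E : Type w} [MeasurableSpace V] [MeasurableSpace E]

theorem BorelGraphField.eq_univ_of_ter_mem (A : BorelGraphField R V E)
    (hA : ∀ x, (A.fiber x).adjGraph.Preconnected) {S : Set V} (hS : A.vert.proj '' S = univ)
    (hter : ∀ e, A.graph.org e ∈ S → A.graph.ter e ∈ S) : S = univ := by
  refine eq_univ_of_forall fun v => ?_
  obtain ⟨r, hr, hrv⟩ := hS.ge (mem_univ (A.vert.proj v))
  have hreach := hA (A.vert.proj v) ⟨r, hrv⟩ ⟨v, rfl⟩
  rw [SimpleGraph.reachable_iff_reflTransGen] at hreach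
  suffices ∀ p, Relation.ReflTransGen (A.fiber (A.vert.proj v)).adjGraph.Adj ⟨r, hrv⟩ p →
    p.1 ∈ S from this _ hreach
  intro p hp
  induction hp with
  | refl => exact hr
  | tail _ hadj ih =>
    obtain ⟨-, e, rfl, rfl⟩ := hadj
    exact hter e.1 ih

/-- Countably many partial Borel sections of the vertices, indexed by a rooted tree of indices in
which the parent of `k + 1` is `par k`, the section `vert (k + 1)` being joined to its parent by a
partial section `edge k` of the edges, such that every orbit of vertices is met by exactly one of
them. Some of the sections may be empty. -/
structure TreeOfSections (A : BorelGraphField R V E) where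
  vert : ℕ → BorelSection A.vert
  dom_zero : (vert 0).dom = univ
  par : ℕ → ℕ
  par_le : ∀ k, par k ≤ k
  edge : ℕ → BorelSection A.edge
  org_mem : ∀ k, ∀ e ∈ edge k, A.graph.org e ∈ vert (par k)
  ter_mem : ∀ k, ∀ e ∈ edge k, A.graph.ter e ∈ vert (k + 1)
  exists_ter_eq : ∀ k, ∀ v ∈ vert (k + 1), ∃ e ∈ edge k, A.graph.ter e = v
  eq_of_orbitRel : ∀ {i j v w}, v ∈ vert i → w ∈ vert j → A.vert.OrbitRel v w → i = j
  exists_orbitRel : ∀ v, ∃ k, ∃ w ∈ vert k, A.vert.OrbitRel v w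

namespace TreeOfSections

variable {A : BorelGraphField R V E} [StandardBorelSpace V]

section Construction

/-- The edges of `W n` which join the stage `m` of the construction of a tree of sections to a new
orbit of vertices, where `k` is the code of `(m, n)`: every pair is treated at some stage. -/
def newEdges (W : ℕ → BorelSection A.edge) (k : ℕ) (C : Fin (k + 1) → BorelSection A.vert) :
    BorelSection A.edge where
  carrier := W k.unpair.2 ∩ (A.graph.org ⁻¹' C ⟨k.unpair.1, Nat.lt_succ_of_le k.unpair_left_le⟩ ∩
    A.graph.ter ⁻¹' ⋂ j, (A.vert.saturation (C j))ᶜ)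
  measurableSet := (W _).measurableSet.inter <|
    (A.org_morphism.measurable (C _).measurableSet).inter <| A.ter_morphism.measurable <|
      .iInter fun j => (A.vert.measurableSet_saturation (C j).measurableSet).compl
  injOn := (W _).injOn.mono inter_subset_left

variable [StandardBorelSpace E] (σ₀ : BorelSection A.vert) (W : ℕ → BorelSection A.edge)

/-- The sections of a tree of sections with root `σ₀`, built along the sections of edges `W n`. -/
def vertexStage : ℕ → BorelSection A.vert
  | 0 => σ₀
  | k + 1 => (newEdges W k fun j => vertexStage j).map A.ter_morphism
decreasing_by exact j.2

theorem vertexStage_zero : vertexStage σ₀ W 0 = σ₀ := by rw [vertexStage]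

theorem vertexStage_succ (k : ℕ) : vertexStage σ₀ W (k + 1) =
    (newEdges W k fun j => vertexStage σ₀ W j).map A.ter_morphism := by rw [vertexStage]

variable {σ₀ W}

theorem mem_vertexStage_succ {k : ℕ} {v : V} : v ∈ vertexStage σ₀ W (k + 1) ↔
    ∃ e ∈ newEdges W k (fun j => vertexStage σ₀ W j), A.graph.ter e = v := by
  rw [vertexStage_succ]
  rfl

theorem notMem_saturation_vertexStage {j k : ℕ} (hjk : j < k) {v : V}
    (hv : v ∈ vertexStage σ₀ W k) : v ∉ A.vert.saturation (vertexStage σ₀ W j) := by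
  obtain ⟨k, rfl⟩ := Nat.exists_eq_succ_of_ne_zero (Nat.ne_zero_of_lt hjk)
  obtain ⟨e, ⟨-, -, he⟩, rfl⟩ := mem_vertexStage_succ.1 hv
  exact mem_iInter.1 he ⟨j, hjk⟩

theorem eq_of_orbitRel_vertexStage {i j : ℕ} {v w : V} (hv : v ∈ vertexStage σ₀ W i)
    (hw : w ∈ vertexStage σ₀ W j) (h : A.vert.OrbitRel v w) : i = j := by
  rcases lt_trichotomy i j with hij | hij | hij
  · exact absurd ⟨v, hv, h.symm⟩ (notMem_saturation_vertexStage hij hw)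
  · exact hij
  · exact absurd ⟨w, hw, h⟩ (notMem_saturation_vertexStage hij hv)

theorem iUnion_saturation_vertexStage (hA : ∀ x, (A.fiber x).adjGraph.Preconnected)
    (hσ₀ : σ₀.dom = univ) (hW : ⋃ n, (W n : Set E) = univ) :
    ⋃ k, A.vert.saturation (vertexStage σ₀ W k) = univ := by
  refine A.eq_univ_of_ter_mem hA (univ_subset_iff.1 (hσ₀ ▸ image_mono ?_)) fun e he => ?_
  · refine fun v hv => mem_iUnion.2 ⟨0, A.vert.subset_saturation _ ?_⟩
    rwa [vertexStage_zero]
  · obtain ⟨m, v, hv, hev⟩ := mem_iUnion.1 he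
    obtain ⟨e', he', rfl⟩ := A.org_morphism.exists_lift hev.symm
    obtain ⟨n, hn⟩ := mem_iUnion.1 (hW.ge (mem_univ e'))
    have hter := (A.ter_morphism.orbitRel he').symm
    suffices ∃ k, A.graph.ter e' ∈ A.vert.saturation (vertexStage σ₀ W k) from
      mem_iUnion.2 (this.imp fun k => hter.mem_saturation_iff.2)
    by_contra! hnew
    refine hnew (Nat.pair m n + 1) (A.vert.subset_saturation _ (mem_vertexStage_succ.2
      ⟨e', ⟨?_, ?_, mem_iInter.2 fun j => hnew j⟩, rfl⟩))
    · rwa [Nat.unpair_pair]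
    · simpa only [mem_preimage, Nat.unpair_pair] using hv

end Construction

theorem nonempty_of_preconnected [StandardBorelSpace X] [StandardBorelSpace E]
    (hA : ∀ x, (A.fiber x).adjGraph.Preconnected) : Nonempty (TreeOfSections A) := by
  obtain ⟨σ₀, hσ₀⟩ := BorelSection.exists_dom_eq_univ A.vert_surjective
  obtain ⟨W, hW⟩ := BorelSection.exists_iUnion_eq_univ A.edge
  exact ⟨{
    vert := vertexStage σ₀ W
    dom_zero := (vertexStage_zero σ₀ W).symm ▸ hσ₀
    par := fun k => k.unpair.1
    par_le := Nat.unpair_left_le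
    edge := fun k => newEdges W k fun j => vertexStage σ₀ W j
    org_mem := fun _ _ he => he.2.1
    ter_mem := fun _ e he => mem_vertexStage_succ.2 ⟨e, he, rfl⟩
    exists_ter_eq := fun _ _ => mem_vertexStage_succ.1
    eq_of_orbitRel := eq_of_orbitRel_vertexStage
    exists_orbitRel := fun v =>
      mem_iUnion.1 ((iUnion_saturation_vertexStage hA hσ₀ hW).ge (mem_univ v)) }⟩

end TreeOfSections

end TreeOfSections

section SectionSystem

open Set MeasureTheory

variable {X : Type u} [MeasurableSpace X] {R : BorelEqRel X}
  {V : Type v} {E : Type w} [MeasurableSpace V] [MeasurableSpace E] {A : BorelGraphField R V E}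

namespace EdgeSection

variable [StandardBorelSpace V] [StandardBorelSpace E]

theorem exists_orbitRel_eq_iUnion_injOn [StandardBorelSpace X] (A : BorelGraphField R V E) :
    ∃ D : ℕ → Set (E × V), (∀ n, MeasurableSet (D n)) ∧
      (∀ n, InjOn (fun p => A.edge.proj p.1) (D n)) ∧
      (∀ n, InjOn (fun p => A.vert.proj p.2) (D n)) ∧
      {p : E × V | A.vert.OrbitRel p.2 (A.graph.ter p.1)} = ⋃ n, D n := by
  have hrel : ∀ p : E × V, A.vert.OrbitRel p.2 (A.graph.ter p.1) →
      R.toSetoid (A.vert.proj p.2) (A.edge.proj p.1) := fun p hp =>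
    A.ter_morphism.proj_map p.1 ▸ hp.rel
  refine exists_iUnion_injOn_injOn (A.edge.measurable_proj.comp measurable_fst)
    (A.vert.measurable_proj.comp measurable_snd) ((measurable_snd.prodMk
      (A.ter_morphism.measurable.comp measurable_fst)) FiberedAction.measurableSet_orbitRel)
    (fun x => ?_) fun x => ?_
  · refine ((A.edge.countable_fiber x).prod (A.vert.countable_preimage_class x)).mono ?_
    rintro p ⟨hp, rfl⟩
    exact ⟨rfl, R.toSetoid.symm (hrel p hp)⟩
  · refine ((A.edge.countable_preimage_class x).prod (A.vert.countable_fiber x)).mono ?_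
    rintro p ⟨hp, rfl⟩
    exact ⟨hrel p hp, rfl⟩

theorem exists_family_orbitRel [StandardBorelSpace X] (σ : ℕ → BorelSection A.vert)
    (hσ : ∀ v, ∃ k, ∃ w ∈ σ k, A.vert.OrbitRel v w) :
    ∃ (src tgt : ℕ → ℕ) (τ : ∀ i, EdgeSection (σ (src i)) (σ (tgt i))),
      ∀ e, ∃ i, ∃ p ∈ τ i, A.edge.OrbitRel e p.1 := by
  obtain ⟨D, hD, hDfst, hDsnd, hDrel⟩ := exists_orbitRel_eq_iUnion_injOn A
  let τ : ∀ m m' : ℕ, ℕ → EdgeSection (σ m) (σ m') := fun m m' n =>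
    { carrier := D n ∩ (A.graph.org ⁻¹' σ m) ×ˢ (σ m' : Set V)
      measurableSet := (hD n).inter
        ((A.org_morphism.measurable (σ m).measurableSet).prod (σ m').measurableSet)
      injOn_fst := (hDfst n).mono inter_subset_left
      injOn_snd := (hDsnd n).mono inter_subset_left
      org_mem := fun p hp => hp.2.1
      snd_mem := fun p hp => hp.2.2
      orbitRel := fun p hp => hDrel.ge (mem_iUnion.2 ⟨n, hp.1⟩) }
  have hτ : ∀ e, ∃ m m' n, ∃ p ∈ τ m m' n, A.edge.OrbitRel e p.1 := fun e => by
    obtain ⟨m, v, hv, hev⟩ := hσ (A.graph.org e)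
    obtain ⟨e', he', rfl⟩ := A.org_morphism.exists_lift hev.symm
    obtain ⟨m', w, hw, hew⟩ := hσ (A.graph.ter e')
    obtain ⟨n, hn⟩ := mem_iUnion.1 (hDrel.le hew.symm : (e', w) ∈ ⋃ n, D n)
    exact ⟨m, m', n, (e', w), ⟨hn, hv, hw⟩, he'.symm⟩
  obtain ⟨code, hcode⟩ := exists_surjective_nat (ℕ × ℕ × ℕ)
  refine ⟨fun i => (code i).1, fun i => (code i).2.1,
    fun i => τ (code i).1 (code i).2.1 (code i).2.2, fun e => ?_⟩
  obtain ⟨m, m', n, p, hp, h⟩ := hτ e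
  obtain ⟨i, hi⟩ := hcode (m, m', n)
  exact ⟨i, p, by beta_reduce; rwa [hi], h⟩

theorem exists_restrict_orbitRel_unique {σ σ' : ℕ → BorelSection A.vert}
    (τ : ∀ i, EdgeSection (σ i) (σ' i)) (hτ : ∀ e, ∃ i, ∃ p ∈ τ i, A.edge.OrbitRel e p.1)
    {M : Set E} (hM : MeasurableSet M)
    (hMinv : ∀ {e e'}, A.edge.OrbitRel e e' → (e ∈ M ↔ e' ∈ M)) :
    ∃ τ' : ∀ i, EdgeSection (σ i) (σ' i), (∀ i, ∀ p ∈ τ' i, p.1 ∈ M) ∧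
      (∀ i j, ∀ p ∈ τ' i, ∀ q ∈ τ' j, A.edge.OrbitRel p.1 q.1 → i = j) ∧
      ∀ e ∈ M, ∃ i, ∃ p ∈ τ' i, A.edge.OrbitRel e p.1 := by
  let D : ℕ → Set E := disjointed fun i => A.edge.saturation (τ i).edges
  have hD : ∀ i, MeasurableSet (D i) := fun i =>
    .disjointed (fun i => A.edge.measurableSet_saturation (τ i).measurableSet_edges) i
  have hDinv : ∀ i {e e'}, A.edge.OrbitRel e e' → (e ∈ D i ↔ e' ∈ D i) := fun i e e' h =>
    disjointedRec (p := fun S => e ∈ S ↔ e' ∈ S)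
      (fun S j hS => and_congr hS (not_congr h.mem_saturation_iff)) h.mem_saturation_iff
  refine ⟨fun i => (τ i).restrict ((hD i).inter hM), fun i p hp => hp.2.2, ?_, fun e he => ?_⟩
  · intro i j p hp q hq h
    by_contra hij
    exact disjoint_left.1 (disjoint_disjointed _ hij) ((hDinv i h).1 hp.2.1) hq.2.1
  · have hcover : e ∈ ⋃ i, D i := by
      obtain ⟨i, p, hp, h⟩ := hτ e
      exact iUnion_disjointed.ge (mem_iUnion.2 ⟨i, p.1, mem_image_of_mem _ hp, h⟩)
    obtain ⟨i, hi⟩ := mem_iUnion.1 hcover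
    obtain ⟨_, ⟨p, hp, rfl⟩, h⟩ := disjointed_subset _ i hi
    exact ⟨i, p, ⟨hp, (hDinv i h).1 hi, (hMinv h).1 he⟩, h⟩

end EdgeSection

namespace TreeOfSections

variable [StandardBorelSpace E] (𝒯 : TreeOfSections A)

/-- The edges in the orbit of an edge of the tree of sections, in either direction. -/
def treeEdges : Set E :=
  ⋃ k, (A.edge.saturation (𝒯.edge k) ∪ A.edge.saturation ((𝒯.edge k).map A.inv_morphism))

theorem measurableSet_treeEdges : MeasurableSet 𝒯.treeEdges :=
  .iUnion fun k => (A.edge.measurableSet_saturation (𝒯.edge k).measurableSet).union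
    (A.edge.measurableSet_saturation (BorelSection.measurableSet _))

variable {𝒯}

theorem mem_treeEdges_iff {e : E} : e ∈ 𝒯.treeEdges ↔
    ∃ k, ∃ f ∈ 𝒯.edge k, A.edge.OrbitRel e f ∨ A.edge.OrbitRel e (A.graph.inv f) := by
  refine mem_iUnion.trans (exists_congr fun k => ⟨?_, ?_⟩)
  · rintro (⟨f, hf, h⟩ | ⟨_, ⟨f, hf, rfl⟩, h⟩)
    exacts [⟨f, hf, .inl h⟩, ⟨f, hf, .inr h⟩]
  · rintro ⟨f, hf, h | h⟩
    exacts [.inl ⟨f, hf, h⟩, .inr ⟨_, mem_image_of_mem _ hf, h⟩]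

theorem mem_treeEdges_iff_of_orbitRel {e e' : E} (h : A.edge.OrbitRel e e') :
    e ∈ 𝒯.treeEdges ↔ e' ∈ 𝒯.treeEdges := by
  simp only [treeEdges, mem_iUnion, mem_union, h.mem_saturation_iff]

end TreeOfSections

/-- A tree of sections together with countably many edge sections between its sections of vertices,
which represent each orbit of the remaining edges exactly once. -/
structure SectionSystem [StandardBorelSpace E] (A : BorelGraphField R V E) extends
    TreeOfSections A where
  src : ℕ → ℕ
  tgt : ℕ → ℕ
  outer : ∀ i, EdgeSection (vert (src i)) (vert (tgt i))
  outer_notMem : ∀ i, ∀ p ∈ outer i, p.1 ∉ toTreeOfSections.treeEdges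
  outer_eq_of_orbitRel : ∀ i j, ∀ p ∈ outer i, ∀ q ∈ outer j, A.edge.OrbitRel p.1 q.1 → i = j
  exists_outer_orbitRel : ∀ e ∉ toTreeOfSections.treeEdges,
    ∃ i, ∃ p ∈ outer i, A.edge.OrbitRel e p.1

theorem SectionSystem.nonempty_of_preconnected [StandardBorelSpace X] [StandardBorelSpace V]
    [StandardBorelSpace E] (hA : ∀ x, (A.fiber x).adjGraph.Preconnected) :
    Nonempty (SectionSystem A) := by
  obtain ⟨𝒯⟩ := TreeOfSections.nonempty_of_preconnected hA
  obtain ⟨src, tgt, τ, hτ⟩ := EdgeSection.exists_family_orbitRel 𝒯.vert 𝒯.exists_orbitRel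
  obtain ⟨τ', hmem, heq, hcover⟩ := EdgeSection.exists_restrict_orbitRel_unique τ hτ
    𝒯.measurableSet_treeEdges.compl
    fun h => not_congr (TreeOfSections.mem_treeEdges_iff_of_orbitRel h)
  exact ⟨⟨𝒯, src, tgt, τ', hmem, heq, hcover⟩⟩

end SectionSystem

section RankedGraphs

open Set

theorem connected_of_forall_exists_adj_lt {V : Type*} {G : SimpleGraph V} (rank : V → ℕ) (root : V)
    (h : ∀ v, v ≠ root → ∃ u, G.Adj u v ∧ rank u < rank v) : G.Connected := by
  refine SimpleGraph.connected_iff_exists_forall_reachable _ |>.2 ⟨root, fun v => ?_⟩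
  induction hn : rank v using Nat.strong_induction_on generalizing v with
  | _ n ih =>
    subst hn
    by_cases hv : v = root
    · rw [hv]
    · obtain ⟨u, huv, hlt⟩ := h v hv
      exact (ih _ hlt u rfl).trans huv.reachable

theorem isAcyclic_of_adj_le_unique {V : Type*} {G : SimpleGraph V} (rank : V → ℕ)
    (h : ∀ u v w, G.Adj u v → G.Adj w v → rank u ≤ rank v → rank w ≤ rank v → u = w) :
    G.IsAcyclic := by
  classical
  intro v c hc
  -- At a vertex of maximal rank, the two neighbours on the cycle have to coincide.
  obtain ⟨m, hm, hmax⟩ := c.support.toFinset.exists_max_image rank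
    ⟨v, List.mem_toFinset.2 c.start_mem_support⟩
  have hm' : m ∈ c.support := List.mem_toFinset.1 hm
  have hle : ∀ n, rank ((c.rotate m hm').getVert n) ≤ rank m := fun n =>
    hmax _ (List.mem_toFinset.2 ((c.mem_support_rotate_iff m hm').1
      (SimpleGraph.Walk.getVert_mem_support _ _)))
  have hc' := hc.rotate hm'
  exact hc'.snd_ne_penultimate (h _ m _ ((c.rotate m hm').adj_snd hc'.not_nil).symm
    ((c.rotate m hm').adj_penultimate hc'.not_nil) (hle _) (hle _))

namespace SerreGraph

variable {V : Type v} {ι : Type w}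

/-- The graph with one pair of opposite edges from `src i` to `tgt i` for each `i`; the edge from
`src i` to `tgt i` is `(i, true)` and its opposite is `(i, false)`. -/
def ofEnds (src tgt : ι → V) : SerreGraph V (ι × Bool) where
  org a := bif a.2 then src a.1 else tgt a.1
  ter a := bif a.2 then tgt a.1 else src a.1
  inv a := (a.1, !a.2)
  inv_inv a := Prod.ext rfl (Bool.not_not a.2)
  inv_ne a h := Bool.not_ne_self a.2 (congrArg Prod.snd h)
  org_inv := by rintro ⟨i, _ | _⟩ <;> rfl

variable {src tgt : ι → V} {T : Set ι} {rank : V → ℕ}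

theorem adj_restrictEdges_ofEnds_iff (hrank : ∀ i ∈ T, rank (src i) < rank (tgt i)) {u v : V} :
    ((ofEnds src tgt).restrictEdges {a | a.1 ∈ T} fun _ h => h).adjGraph.Adj u v ↔
      ∃ i ∈ T, src i = u ∧ tgt i = v ∨ src i = v ∧ tgt i = u := by
  constructor
  · rintro ⟨-, ⟨⟨i, _ | _⟩, hi⟩, rfl, rfl⟩
    exacts [⟨i, hi, .inr ⟨rfl, rfl⟩⟩, ⟨i, hi, .inl ⟨rfl, rfl⟩⟩]
  · have hne : ∀ i ∈ T, src i ≠ tgt i := fun i hi h => (hrank i hi).ne (congrArg rank h)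
    rintro ⟨i, hi, ⟨rfl, rfl⟩ | ⟨rfl, rfl⟩⟩
    exacts [⟨hne i hi, ⟨(i, true), hi⟩, rfl, rfl⟩, ⟨(hne i hi).symm, ⟨(i, false), hi⟩, rfl, rfl⟩]

theorem isTree_restrictEdges_ofEnds (root : V) (hrank : ∀ i ∈ T, rank (src i) < rank (tgt i))
    (hinj : InjOn tgt T) (hsurj : ∀ v, v ≠ root → ∃ i ∈ T, tgt i = v) :
    ((ofEnds src tgt).restrictEdges {a | a.1 ∈ T} fun _ h => h).IsTree := by
  refine ⟨?_, ?_, connected_of_forall_exists_adj_lt rank root fun v hv => ?_,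
    isAcyclic_of_adj_le_unique rank fun u v w huv hwv hu hw => ?_⟩
  · rintro ⟨⟨i, _ | _⟩, hi⟩ h
    exacts [(hrank i hi).ne' (congrArg rank h), (hrank i hi).ne (congrArg rank h)]
  · rintro ⟨⟨i, b⟩, hi⟩ ⟨⟨j, c⟩, hj⟩ horg hter
    have h1 := congrArg rank horg
    have h2 := congrArg rank hter
    have := hrank i hi
    have := hrank j hj
    cases b <;> cases c <;> dsimp only [restrictEdges, ofEnds, cond] at horg hter h1 h2
    · obtain rfl := hinj hi hj horg; rfl
    · omega
    · omega
    · obtain rfl := hinj hi hj hter; rfl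
  · obtain ⟨i, hi, rfl⟩ := hsurj v hv
    exact ⟨src i, (adj_restrictEdges_ofEnds_iff hrank).2 ⟨i, hi, .inl ⟨rfl, rfl⟩⟩, hrank i hi⟩
  · obtain ⟨i, hi, ⟨rfl, rfl⟩ | ⟨rfl, rfl⟩⟩ := (adj_restrictEdges_ofEnds_iff hrank).1 huv
    · obtain ⟨j, hj, ⟨rfl, hij⟩ | ⟨hij, rfl⟩⟩ := (adj_restrictEdges_ofEnds_iff hrank).1 hwv
      · rw [hinj hj hi hij]
      · exact absurd hw (hij ▸ hrank j hj).not_ge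
    · exact absurd hu (hrank i hi).not_ge

end SerreGraph

end RankedGraphs

section Quotient

open Set

variable {X : Type u} [MeasurableSpace X] [StandardBorelSpace X] {R : BorelEqRel X}
  {V : Type v} {E : Type w} [MeasurableSpace V] [MeasurableSpace E]
  [StandardBorelSpace V] [StandardBorelSpace E] {A : BorelGraphField R V E}

namespace SectionSystem

variable (𝒮 : SectionSystem A)

/-- The index of the section of vertices in which an edge section starts. The edges of the tree of
sections are indexed by the left summand of `ℕ ⊕ ℕ` and the outer ones by the right summand. -/
def edgeSrc : ℕ ⊕ ℕ → ℕ := Sum.elim 𝒮.par 𝒮.src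

/-- The index of the section of vertices in which an edge section ends. -/
def edgeTgt : ℕ ⊕ ℕ → ℕ := Sum.elim Nat.succ 𝒮.tgt

/-- The edge sections of the tree of sections together with the outer ones. -/
def edgeSection : ∀ i, EdgeSection (𝒮.vert (𝒮.edgeSrc i)) (𝒮.vert (𝒮.edgeTgt i))
  | .inl k => .ofSection (𝒮.edge k) (𝒮.org_mem k) (𝒮.ter_mem k)
  | .inr i => 𝒮.outer i

/-- The vertices of the quotient graph: the nonempty sections of vertices. -/
abbrev VertIndex : Type := {k // (𝒮.vert k).dom.Nonempty}

/-- The geometric edges of the quotient graph: the nonempty edge sections. -/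
abbrev EdgeIndex : Type := {i // (𝒮.edgeSection i).φ.source.Nonempty}

/-- The origin of a geometric edge of the quotient graph. -/
def srcVert (i : 𝒮.EdgeIndex) : 𝒮.VertIndex :=
  ⟨𝒮.edgeSrc i, i.2.elim fun x hx => ⟨_, ((𝒮.edgeSection i).orgMap ⟨x, hx⟩).2⟩⟩

/-- The terminus of a geometric edge of the quotient graph. -/
def tgtVert (i : 𝒮.EdgeIndex) : 𝒮.VertIndex :=
  ⟨𝒮.edgeTgt i, i.2.elim fun x hx => ⟨_, ((𝒮.edgeSection i).terMap ⟨x, hx⟩).2⟩⟩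

/-- The quotient graph, with the restrictions of the orbit relations to the sections. The edge
`(i, true)` goes along the edge section `i` and `(i, false)` along its opposite. -/
noncomputable def relGraph : GraphOfRelations.{u} where
  Vert := 𝒮.VertIndex
  Edge := 𝒮.EdgeIndex × Bool
  graph := .ofEnds 𝒮.srcVert 𝒮.tgtVert
  vRel k := (𝒮.vert k).relSpace
  eRel a := (𝒮.edgeSection a.1).relSpace
  eRel_inv _ := rfl
  mor
    | (i, true) => (𝒮.edgeSection i).terMap
    | (i, false) => (𝒮.edgeSection i).orgMap
  measurable_mor
    | (i, true) => (𝒮.edgeSection i).measurable_terMap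
    | (i, false) => (𝒮.edgeSection i).measurable_orgMap
  injective_mor
    | (i, true) => (𝒮.edgeSection i).injective_terMap
    | (i, false) => (𝒮.edgeSection i).injective_orgMap
  mor_rel
    | (i, true), _, _, h => (𝒮.edgeSection i).orbitRel_apply_terMap h
    | (i, false), _, _, h => (𝒮.edgeSection i).orbitRel_apply_orgMap h

/-- The point of `X` under a point of the quotient graph of relations. -/
def point (p : 𝒮.relGraph.TotV) : X := Subtype.val (p := (· ∈ (𝒮.vert p.1.1).dom)) p.2

/-- The vertex of `A` represented by a point of the quotient graph of relations. -/
noncomputable def onV (p : 𝒮.relGraph.TotV) : V := 𝒮.vert p.1.1 p.2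

/-- The edge of `A` represented by a point of an edge of the quotient graph of relations. -/
noncomputable def onE : 𝒮.relGraph.TotE → E
  | ⟨(i, true), x⟩ => (𝒮.edgeSection i).s x
  | ⟨(i, false), x⟩ => A.graph.inv ((𝒮.edgeSection i).s x)

/-- The edges of the maximal subtree of the quotient graph. -/
def quotientTree : Set 𝒮.relGraph.Edge := {a : 𝒮.EdgeIndex × Bool | a.1.1.isLeft}

/-- The orientation of the quotient graph given by the edge sections. -/
def orientation : Set 𝒮.relGraph.Edge := {a : 𝒮.EdgeIndex × Bool | a.2 = true}

theorem measurable_onV : Measurable 𝒮.onV :=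
  measurable_of_measurable_sigma fun k => (𝒮.vert k.1).measurable

theorem measurable_onE : Measurable 𝒮.onE := measurable_of_measurable_sigma fun
  | (i, true) => (𝒮.edgeSection i).measurable_s
  | (i, false) => A.inv_morphism.measurable.comp (𝒮.edgeSection i).measurable_s

theorem inv_onE (e : 𝒮.relGraph.TotE) : A.graph.inv (𝒮.onE e) = 𝒮.onE (𝒮.relGraph.flip e) := by
  obtain ⟨⟨i, _ | _⟩, x⟩ := e
  exacts [A.graph.inv_inv _, rfl]

theorem injective_onE (a : 𝒮.relGraph.Edge) : Function.Injective fun x => 𝒮.onE ⟨a, x⟩ := by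
  obtain ⟨i, _ | _⟩ := a
  exacts [(Function.Involutive.injective A.graph.inv_inv).comp (EdgeSection.injective_s _),
    EdgeSection.injective_s _]

theorem orbitRel_onE_iff (a : 𝒮.relGraph.Edge) (x y : (𝒮.relGraph.eRel a).carrier) :
    (𝒮.relGraph.eRel a).rel.toSetoid x y ↔ A.edge.OrbitRel (𝒮.onE ⟨a, x⟩) (𝒮.onE ⟨a, y⟩) := by
  obtain ⟨i, _ | _⟩ := a
  · refine ⟨A.inv_morphism.orbitRel, fun h => ?_⟩
    have h' := A.inv_morphism.orbitRel h
    rwa [inv_onE, inv_onE] at h'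
  · exact Iff.rfl

theorem proj_onV (p : 𝒮.relGraph.TotV) : A.vert.proj (𝒮.onV p) = 𝒮.point p :=
  BorelSection.proj_apply _ _

theorem eq_of_orbitRel_onV {p q : 𝒮.relGraph.TotV} (h : A.vert.OrbitRel (𝒮.onV p) (𝒮.onV q)) :
    p.1 = q.1 :=
  Subtype.ext (𝒮.eq_of_orbitRel (BorelSection.apply_mem _ _) (BorelSection.apply_mem _ _) h)

theorem injective_onV : Function.Injective 𝒮.onV := by
  rintro ⟨k, x⟩ ⟨l, y⟩ h
  obtain rfl : k = l := 𝒮.eq_of_orbitRel_onV (.of_eq h)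
  exact congrArg (Sigma.mk k) (BorelSection.injective _ h)

theorem ter_onE {e : 𝒮.relGraph.TotE} (he : e.1 ∈ 𝒮.quotientTree) :
    A.graph.ter (𝒮.onE e) = 𝒮.onV (𝒮.relGraph.ter e) := by
  obtain ⟨⟨⟨k | i, hi⟩, _ | _⟩, x⟩ := e
  · exact (A.graph.ter_inv _).trans (EdgeSection.apply_orgMap _ x).symm
  · exact (EdgeSection.apply_terMap_ofSection (𝒮.org_mem k) (𝒮.ter_mem k) x).symm
  all_goals exact absurd he Bool.false_ne_true

theorem org_onE {e : 𝒮.relGraph.TotE} (he : e.1 ∈ 𝒮.quotientTree) :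
    A.graph.org (𝒮.onE e) = 𝒮.onV (𝒮.relGraph.org e) := by
  rw [← A.graph.ter_inv, inv_onE]
  exact 𝒮.ter_onE (e := 𝒮.relGraph.flip e) he

theorem point_eq_of_eqvGen {p q : 𝒮.relGraph.TotV}
    (h : Relation.EqvGen (𝒮.relGraph.Step 𝒮.quotientTree) p q) : 𝒮.point p = 𝒮.point q := by
  induction h with
  | rel _ _ h =>
    obtain ⟨e, he, rfl, rfl⟩ := h
    rw [← proj_onV, ← proj_onV, ← 𝒮.ter_onE he, ← 𝒮.org_onE he, A.org_morphism.proj_map,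
      A.ter_morphism.proj_map]
  | refl => rfl
  | symm _ _ _ ih => exact ih.symm
  | trans _ _ _ _ _ ih ih' => exact ih.trans ih'

theorem exists_terMap_eq {k : ℕ} (x : (𝒮.vert (k + 1)).dom) :
    ∃ y, (𝒮.edgeSection (.inl k)).terMap y = x := by
  obtain ⟨e, he, hex⟩ := 𝒮.exists_ter_eq k _ (BorelSection.apply_mem _ x)
  obtain ⟨y, rfl⟩ := (EdgeSection.range_s_ofSection (𝒮.org_mem k) (𝒮.ter_mem k)).ge he
  exact ⟨y, BorelSection.injective _ ((EdgeSection.apply_terMap_ofSection _ _ y).trans hex)⟩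

theorem onE_mem_treeEdges {e : 𝒮.relGraph.TotE} (he : e.1 ∈ 𝒮.quotientTree) :
    𝒮.onE e ∈ 𝒮.treeEdges := by
  obtain ⟨⟨⟨k | i, hi⟩, b⟩, x⟩ := e
  · have hx : (𝒮.edgeSection (.inl k)).s x ∈ 𝒮.edge k :=
      (EdgeSection.range_s_ofSection (𝒮.org_mem k) (𝒮.ter_mem k)).le (mem_range_self x)
    cases b
    exacts [TreeOfSections.mem_treeEdges_iff.2 ⟨k, _, hx, .inr (.refl _ _)⟩,
      TreeOfSections.mem_treeEdges_iff.2 ⟨k, _, hx, .inl (.refl _ _)⟩]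
  · exact absurd he Bool.false_ne_true

theorem exists_mem_outer {e : 𝒮.relGraph.TotE} (he : e.1 ∈ 𝒮.orientation)
    (he' : e.1 ∉ 𝒮.quotientTree) : ∃ i, e.1.1.1 = .inr i ∧ ∃ p ∈ 𝒮.outer i, p.1 = 𝒮.onE e := by
  obtain ⟨⟨⟨k | i, hi⟩, _ | _⟩, x⟩ := e
  exacts [absurd he Bool.false_ne_true, absurd rfl he', absurd he Bool.false_ne_true,
    ⟨i, rfl, _, (𝒮.outer i).pair_mem x, rfl⟩]

theorem onE_notMem_treeEdges {e : 𝒮.relGraph.TotE} (he : e.1 ∈ 𝒮.orientation)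
    (he' : e.1 ∉ 𝒮.quotientTree) : 𝒮.onE e ∉ 𝒮.treeEdges := by
  obtain ⟨i, -, p, hp, hpe⟩ := 𝒮.exists_mem_outer he he'
  exact hpe ▸ 𝒮.outer_notMem i p hp

theorem exists_orbitRel_onE (f : E) : ∃ e : 𝒮.relGraph.TotE,
    e.1 ∈ 𝒮.quotientTree ∪ 𝒮.orientation ∧ A.edge.OrbitRel f (𝒮.onE e) := by
  by_cases hf : f ∈ 𝒮.treeEdges
  · obtain ⟨k, g, hg, h⟩ := TreeOfSections.mem_treeEdges_iff.1 hf
    obtain ⟨y, rfl⟩ := (EdgeSection.range_s_ofSection (𝒮.org_mem k) (𝒮.ter_mem k)).ge hg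
    rcases h with h | h
    exacts [⟨⟨(⟨.inl k, y, y.2⟩, true), y⟩, .inl rfl, h⟩,
      ⟨⟨(⟨.inl k, y, y.2⟩, false), y⟩, .inl rfl, h⟩]
  · obtain ⟨i, p, hp, h⟩ := 𝒮.exists_outer_orbitRel f hf
    obtain ⟨y, hy⟩ := (𝒮.outer i).range_s.ge (mem_image_of_mem _ hp)
    exact ⟨⟨(⟨.inr i, y, y.2⟩, true), y⟩, .inr rfl, h.trans (.of_eq hy.symm)⟩

variable [Nonempty X]

/-- The vertex of the quotient graph which carries `X`. -/
def root : 𝒮.VertIndex := ⟨0, 𝒮.dom_zero ▸ univ_nonempty⟩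

/-- The point of the root space corresponding to a point of `X`. -/
def rootPoint (x : X) : (𝒮.relGraph.vRel 𝒮.root).carrier :=
  (⟨x, 𝒮.dom_zero ▸ mem_univ x⟩ : (𝒮.vert 0).dom)

theorem isTree_quotientTree :
    (𝒮.relGraph.graph.restrictEdges 𝒮.quotientTree fun _ h => h).IsTree := by
  refine SerreGraph.isTree_restrictEdges_ofEnds (src := 𝒮.srcVert)
    (tgt := 𝒮.tgtVert) (T := {i : 𝒮.EdgeIndex | i.1.isLeft}) (rank := Subtype.val) 𝒮.root ?_ ?_ ?_
  · rintro ⟨k | i, hi⟩ h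
    exacts [Nat.lt_succ_of_le (𝒮.par_le k), absurd h Bool.false_ne_true]
  · rintro ⟨k | i, hi⟩ h ⟨l | j, hj⟩ h' hij
    · obtain rfl : k = l := Nat.succ_injective (congrArg Subtype.val hij)
      rfl
    exacts [absurd h' Bool.false_ne_true, absurd h Bool.false_ne_true,
      absurd h Bool.false_ne_true]
  · rintro ⟨_ | k, hk⟩ h
    · exact absurd rfl h
    · obtain ⟨y, -⟩ := 𝒮.exists_terMap_eq ⟨_, hk.some_mem⟩
      exact ⟨⟨.inl k, y, y.2⟩, rfl, rfl⟩

theorem eqvGen_rootPoint (p : 𝒮.relGraph.TotV) :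
    Relation.EqvGen (𝒮.relGraph.Step 𝒮.quotientTree) ⟨𝒮.root, 𝒮.rootPoint (𝒮.point p)⟩ p := by
  obtain ⟨⟨k, hk⟩, x⟩ := p
  induction k using Nat.strong_induction_on with
  | _ k ih =>
    obtain _ | k := k
    · exact .refl _
    · obtain ⟨y, hy⟩ := 𝒮.exists_terMap_eq x
      let i : 𝒮.EdgeIndex := ⟨.inl k, y, y.2⟩
      have hstep : 𝒮.relGraph.Step 𝒮.quotientTree
          ⟨𝒮.srcVert i, (𝒮.edgeSection i).orgMap y⟩ ⟨⟨k + 1, hk⟩, x⟩ :=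
        ⟨⟨(i, true), y⟩, rfl, rfl, congrArg (Sigma.mk _) hy⟩
      rw [← 𝒮.point_eq_of_eqvGen (.rel _ _ hstep)]
      exact .trans _ _ _ (ih (𝒮.par k) (Nat.lt_succ_of_le (𝒮.par_le k)) _ _) (.rel _ _ hstep)

/-- The maximal subtree of the quotient graph of relations, with its root. -/
def rootedTree : 𝒮.relGraph.RootedMaximalTree where
  edges := 𝒮.quotientTree
  inv_mem _ h := h
  isTree := 𝒮.isTree_quotientTree
  root := 𝒮.root
  root_fundamental p := ⟨_, 𝒮.eqvGen_rootPoint p, fun (_ : (𝒮.vert 0).dom) hy =>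
    Subtype.ext (𝒮.point_eq_of_eqvGen hy)⟩

theorem eq_of_orbitRel_onE {e e' : 𝒮.relGraph.TotE} (he : e.1 ∈ 𝒮.quotientTree ∪ 𝒮.orientation)
    (he' : e'.1 ∈ 𝒮.quotientTree ∪ 𝒮.orientation)
    (h : A.edge.OrbitRel (𝒮.onE e) (𝒮.onE e')) : e.1 = e'.1 := by
  have hiff := TreeOfSections.mem_treeEdges_iff_of_orbitRel (𝒯 := 𝒮.toTreeOfSections) h
  by_cases ht : e.1 ∈ 𝒮.quotientTree <;> by_cases ht' : e'.1 ∈ 𝒮.quotientTree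
  · have hter := A.ter_morphism.orbitRel h
    have horg := A.org_morphism.orbitRel h
    rw [𝒮.ter_onE ht, 𝒮.ter_onE ht'] at hter
    rw [𝒮.org_onE ht, 𝒮.org_onE ht'] at horg
    exact congrArg Subtype.val (𝒮.isTree_quotientTree.2.1 ⟨e.1, ht⟩ ⟨e'.1, ht'⟩
      (((𝒮.relGraph.graph.ter_inv _).symm.trans (𝒮.eq_of_orbitRel_onV horg)).trans
        (𝒮.relGraph.graph.ter_inv _)) (𝒮.eq_of_orbitRel_onV hter))
  · exact absurd (hiff.1 (𝒮.onE_mem_treeEdges ht))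
      (𝒮.onE_notMem_treeEdges (he'.resolve_left ht') ht')
  · exact absurd (hiff.2 (𝒮.onE_mem_treeEdges ht'))
      (𝒮.onE_notMem_treeEdges (he.resolve_left ht) ht)
  · replace he := he.resolve_left ht
    replace he' := he'.resolve_left ht'
    obtain ⟨i, hi, p, hp, hpe⟩ := 𝒮.exists_mem_outer he ht
    obtain ⟨j, hj, q, hq, hqe⟩ := 𝒮.exists_mem_outer he' ht'
    obtain rfl := 𝒮.outer_eq_of_orbitRel i j p hp q hq (hpe ▸ hqe ▸ h)
    exact Prod.ext (Subtype.ext (hi.trans hj.symm)) (Eq.trans he (Eq.symm he'))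

/-- The representation in `A` of the maximal subtree. -/
noncomputable def representation : TreeRepresentation 𝒮.rootedTree A where
  base := fun y : (𝒮.vert 0).dom => (y : X)
  base_embedding := .subtype_coe (𝒮.vert 0).measurableSet_dom
  onV := 𝒮.onV
  onE e := 𝒮.onE e.1
  measurable_onV := 𝒮.measurable_onV
  measurable_onE := 𝒮.measurable_onE.comp measurable_subtype_coe
  injective_onV := 𝒮.injective_onV
  injective_onE := by
    rintro ⟨⟨a, x⟩, ha⟩ ⟨⟨b, y⟩, hb⟩ h
    obtain rfl : a = b := 𝒮.eq_of_orbitRel_onE (e := ⟨a, x⟩) (e' := ⟨b, y⟩) (.inl ha) (.inl hb)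
      (.of_eq h)
    obtain rfl := 𝒮.injective_onE a h
    rfl
  proj_onV y p h := (𝒮.proj_onV p).trans (𝒮.point_eq_of_eqvGen h).symm
  org_onE e := 𝒮.org_onE e.2
  ter_onE e := 𝒮.ter_onE e.2
  inv_onE e := 𝒮.inv_onE e.1
  vRel_iff _ _ _ := Iff.rfl
  eRel_iff a _ := 𝒮.orbitRel_onE_iff a

theorem isArboretumOfRepresentatives : 𝒮.representation.IsArboretumOfRepresentatives := by
  refine FiberedAction.isPartitionFamily_saturation ?_ ?_ fun v => ?_
  · rintro ⟨k, x, hx⟩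
    exact ⟨_, (⟨x, hx⟩ : (𝒮.vert k).dom), rfl⟩
  · rintro P Q _ ⟨x, rfl⟩ _ ⟨y, rfl⟩ h
    exact 𝒮.eq_of_orbitRel_onV h
  · obtain ⟨k, w, hw, h⟩ := 𝒮.exists_orbitRel v
    exact ⟨⟨k, _, BorelSection.proj_mem_dom hw⟩, w,
      ⟨(⟨_, BorelSection.proj_mem_dom hw⟩ : (𝒮.vert k).dom), (BorelSection.apply_eq_iff hw).2 rfl⟩,
      h⟩

/-- The oriented edges of the quotient graph outside the maximal subtree. -/
abbrev OuterEdge : Type := {a : 𝒮.relGraph.Edge // a ∈ 𝒮.orientation ∧ a ∉ 𝒮.rootedTree.edges}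

theorem edge_partition : IsPartitionFamily
    (Sum.elim (fun a : 𝒮.rootedTree.edges => A.edge.saturation (𝒮.representation.edgeRep a))
      (fun a : 𝒮.OuterEdge => A.edge.saturation (range (𝒮.edgeSection a.1.1).s))) := by
  let edgeOf : 𝒮.rootedTree.edges ⊕ 𝒮.OuterEdge → 𝒮.relGraph.Edge := Sum.elim (↑) (↑)
  have hmem : ∀ a, edgeOf a ∈ 𝒮.quotientTree ∪ 𝒮.orientation := by
    rintro (a | a)
    exacts [.inl a.2, .inr a.2.1]
  have hinj : Function.Injective edgeOf :=
    Subtype.val_injective.sumElim Subtype.val_injective fun a b h => b.2.2 (h ▸ a.2)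
  convert FiberedAction.isPartitionFamily_saturation (Φ := A.edge)
    (S := fun a => range fun x => 𝒮.onE ⟨edgeOf a, x⟩) (fun a => ?_) ?_ fun f => ?_ with a
  · rcases a with a | ⟨⟨i, b⟩, h, h'⟩
    · rfl
    · obtain rfl : b = true := h
      rfl
  · obtain ⟨x, hx⟩ := (edgeOf a).1.2
    exact ⟨_, (⟨x, hx⟩ : (𝒮.edgeSection _).φ.source), rfl⟩
  · rintro a b _ ⟨x, rfl⟩ _ ⟨y, rfl⟩ h
    exact hinj (𝒮.eq_of_orbitRel_onE (hmem a) (hmem b) h)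
  · obtain ⟨⟨a, x⟩, ha, h⟩ := 𝒮.exists_orbitRel_onE f
    by_cases ht : a ∈ 𝒮.quotientTree
    exacts [⟨.inl ⟨a, ht⟩, _, ⟨x, rfl⟩, h⟩,
      ⟨.inr ⟨a, ha.resolve_left ht, ht⟩, _, ⟨x, rfl⟩, h⟩]

theorem φ_toBase_org (i : 𝒮.EdgeIndex) (x : (𝒮.edgeSection i).φ.source) :
    (𝒮.edgeSection i).φ.toPartialEquiv
        (𝒮.representation.toBase (𝒮.relGraph.org ⟨(i, true), x⟩)) =
      𝒮.representation.toBase (𝒮.relGraph.ter ⟨(i, true), x⟩) := by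
  have horg : 𝒮.representation.toBase (𝒮.relGraph.org ⟨(i, true), x⟩) = (x : X) :=
    BorelSection.proj_apply _ _
  have hter : 𝒮.representation.toBase (𝒮.relGraph.ter ⟨(i, true), x⟩) =
      (𝒮.edgeSection i).φ.toPartialEquiv (x : X) := BorelSection.proj_apply _ _
  exact (congrArg _ horg).trans hter.symm

/-- The quotient graph of relations as a desingularization. -/
noncomputable def desingularization : Desingularization A where
  G := 𝒮.relGraph
  orientation := 𝒮.orientation
  orientation_iff a := by
    change a.2 = true ↔ ¬ (!a.2) = true
    rw [Bool.not_eq_true, Bool.not_eq_false']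
  T := 𝒮.rootedTree
  χ := 𝒮.representation
  representatives := 𝒮.isArboretumOfRepresentatives
  base_surjective x := ⟨𝒮.rootPoint x, rfl⟩
  φ a := (𝒮.edgeSection a.1.1).φ
  s a := (𝒮.edgeSection a.1.1).s
  measurable_s a := (𝒮.edgeSection a.1.1).measurable_s
  proj_s a := (𝒮.edgeSection a.1.1).proj_s
  org_s := by
    rintro ⟨⟨i, b⟩, h, h'⟩ x
    obtain rfl : b = true := h
    exact ⟨(𝒮.edgeSection i).orgMap x, (𝒮.edgeSection i).apply_orgMap x⟩
  ter_s := by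
    rintro ⟨⟨i, b⟩, h, h'⟩ x
    obtain rfl : b = true := h
    obtain ⟨h, hact⟩ := (𝒮.edgeSection i).exists_act_ter_s x
    exact ⟨h, (𝒮.edgeSection i).terMap x, hact.symm⟩
  iso_org := by
    rintro ⟨⟨i, b⟩, h, h'⟩
    obtain rfl : b = true := h
    exact EdgeSection.inducesIso_source fun x => BorelSection.proj_apply _ _
  iso_ter := by
    rintro ⟨⟨i, b⟩, h, h'⟩
    obtain rfl : b = true := h
    exact EdgeSection.inducesIso_target fun x => BorelSection.proj_apply _ _
  φ_org := by
    rintro ⟨⟨i, b⟩, h, h'⟩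
    obtain rfl : b = true := h
    exact 𝒮.φ_toBase_org i
  edge_partition := 𝒮.edge_partition

end SectionSystem
end Quotient

theorem mainTheorem6_general {X : Type u} [MeasurableSpace X] [StandardBorelSpace X] [Nonempty X]
    (R : BorelEqRel X) {V : Type v} [MeasurableSpace V] [StandardBorelSpace V]
    {E : Type w} [MeasurableSpace E] [StandardBorelSpace E]
    (A : BorelGraphField R V E) (hA : ∀ x, (A.fiber x).adjGraph.Preconnected) :
    Nonempty (Desingularization A) := by
  obtain ⟨𝒮⟩ := SectionSystem.nonempty_of_preconnected hA
  exact ⟨𝒮.desingularization⟩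

theorem mainTheorem6 {X : Type u} [MeasurableSpace X] [StandardBorelSpace X] [Nonempty X]
    (R : BorelEqRel X) {V : Type v} [MeasurableSpace V] [StandardBorelSpace V]
    {E : Type w} [MeasurableSpace E] [StandardBorelSpace E]
    (A : BorelGraphField R V E) (hA : A.IsArboretum) :
    Nonempty (Desingularization A) :=
  mainTheorem6_general R A fun x => (hA x).2.2.1.preconnected
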